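/- For integers $\ell,h\ge 0$, an $\ell$-configuration of size $h$ is a finite vertex set partitioned into parts $U_1,\dots,U_\ell$ together with a list of $h$ edges $e_1,\dots,e_h$ (sets of vertices, repetitions allowed), each edge having exactly one vertex in each part. For a finite set $I$ of coordinates, vectors $y^1,\dots,y^h\in[m]^I$ realise it if there is an injection $\Phi:\{1,\dots,\ell\}\to I$ such that for all distinct $j,j'\in\{1,\dots,h\}$ and all $i\in I$ we have $y^j_i=y^{j'}_i$ if and only if $i=\Phi(p)$ for some $p$ with $e_j\cap e_{j'}\cap U_p\neq\emptyset$. A dictator in $[m]^I$ is a set $\{x\in[m]^I: x_i=a\}$ with $i\in I$, $a\in[m]$. With $\mu$ the uniform probability measure on $[m]^I$, a code $\mathcal F\subset[m]^I$ is $(r,\varepsilon)$-uncapturable if $\mu(\mathcal F\setminus\bigcup\mathcal D)>\varepsilon$ for every set $\mathcal D$ of at most $r$ dictators. Theorem. For any configuration $\mathcal H$ of size $h$ and any $k\in\mathbb N$ there are $r,m_0,N\in\mathbb N$ such that the following holds whenever $m\ge m_0$ and $n\ge N\log m$. Let $R_1,\dots,R_h\subset[n]$ with $|R_j|\le k$ for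 all $j$, let $\mathcal A_j\subset[m]^{[n]\setminus R_j}$ be $(r,m^{-k})$-uncapturable for all $j$, and let $T=\bigcup_{j}R_j$. Then there are $x^j\in\mathcal A_j$ for $j=1,\dots,h$ such that the restrictions $y^j=x^j_{[n]\setminus T}\in[m]^{[n]\setminus T}$ realise $\mathcal H$. -/

import Mathlib

/-- An `ℓ`-configuration of size `h` with vertex set `V`: the vertex set is partitioned into parts
`U_k = {v | part v = k}`, `k : Fin ℓ`, and there are `h` edges `e_j` (repetitions allowed), each
having exactly one vertex in each part. -/
structure Configuration (V : Type*) (ℓ h : ℕ) where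
  part : V → Fin ℓ
  edge : Fin h → Set V
  existsUnique_mem : ∀ j k, ∃! v, v ∈ edge j ∧ part v = k

/-- The vectors `y j : ι → α`, `j : Fin h`, realise the configuration `H`: there is an injection `Φ`
of the parts of `H` into the coordinates such that any two distinct vectors `y j`, `y j'` agree in
exactly those coordinates `Φ k` for which `e_j ∩ e_j' ∩ U_k` is nonempty. -/
def Configuration.Realises {V : Type*} {ℓ h : ℕ} (H : Configuration V ℓ h) {ι α : Type*}
    (y : Fin h → ι → α) : Prop :=
  ∃ Φ : Fin ℓ ↪ ι, ∀ j j' : Fin h, j ≠ j' → ∀ i : ι,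
    (y j i = y j' i ↔ ∃ k, i = Φ k ∧ (H.edge j ∩ H.edge j' ∩ {v | H.part v = k}).Nonempty)

/-- The uniform probability of a subset of a finite type. -/
noncomputable def uniformProb {Ω : Type*} (F : Set Ω) : ℝ :=
  (F.ncard : ℝ) / (Nat.card Ω : ℝ)

/-- The dictator `D_{i → a}`: all vectors whose coordinate `i` has value `a`. -/
def dictator {ι α : Type*} (i : ι) (a : α) : Set (ι → α) :=
  {x | x i = a}

/-- A code is `(r, ε)`-capturable if removing at most `r` dictators from it leaves a set of uniform
measure at most `ε`. -/
def Capturable {ι α : Type*} (r : ℕ) (ε : ℝ) (F : Set (ι → α)) : Prop :=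
  ∃ D : Finset (ι × α), D.card ≤ r ∧ uniformProb (F \ ⋃ d ∈ D, dictator d.1 d.2) ≤ ε

/-- A code is `(r, ε)`-uncapturable if it is not `(r, ε)`-capturable. -/
def Uncapturable {ι α : Type*} (r : ℕ) (ε : ℝ) (F : Set (ι → α)) : Prop :=
  ¬ Capturable r ε F

/-- Given `x ∈ [m]^{[n] ∖ S}` and `S ⊆ T`, the restriction of `x` to `[n] ∖ T`. -/
def restrictOutside {n m : ℕ} {S T : Finset (Fin n)} (hST : S ⊆ T)
    (x : {i : Fin n // i ∉ S} → Fin m) : {i : Fin n // i ∉ T} → Fin m :=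
  fun i => x ⟨i.1, fun hi => i.2 (hST hi)⟩

set_option linter.unusedSectionVars false

namespace ProductCube

open Finset Function
open scoped BigOperators

variable {ι α : Type*} [Fintype ι] [DecidableEq ι] [Fintype α] [DecidableEq α] [Nonempty α]

/-! View each code as a function on the whole cube that ignores the coordinates in its `R j`. The
core case asks for points in the supports of functions `w j` that pairwise differ in every
coordinate. Choose disjoint blocks of about `m / (h + 1)` letters, one per function, and pull them
back by common random permutations, independent over the coordinates. Points from different blocks
then differ everywhere, so it suffices that every `w j` has nonzero density on its random subcube.
The variance of that density is `stab lam w - μ ^ 2` with correlation `lam = O(h / m)`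
(`expect_subcubeMean_sub_sq`), and a second-moment argument finishes
(`exists_pairwise_disagreeing`).

The variance is small when `w` is global, i.e. no restriction increases its mean too much
(`IsGlobal.stab_sub_sq_le`). This rests on `hypercontractive`, which bounds high norms after noise
by two-norms of derivatives; derivatives are averages of restrictions, and for global functions
these are controlled by induction.

General codes are reduced to this case. A density increment makes each function global after fixing
boundedly many coordinates (`exists_global_restriction`). Fixed values must not collide:
uncapturability allows the values already fixed for other codes to be deleted first
(`exists_global_restrictions`), and globalness later allows deletion of the others' fixed values at
free coordinates (`IsGlobal.le_expect_avoid`). The prescribed agreements are placed on coordinates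
where many letters preserve half of every density; these exist because `log (1 / density) = O(log
m)` while `n ≥ N log m` (`exists_popular_coord`). -/

/-! ### Averages over a product cube. -/

lemma expect_update (i : ι) (F : (ι → α) → ℝ) :
    𝔼 x, 𝔼 c, F (update x i c) = 𝔼 x, F x := by
  have h : 𝔼 x : (ι → α) × α, F (update x.1 i x.2) = 𝔼 x : (ι → α) × α, F x.1 := by
    refine Fintype.expect_equiv
      (Function.Involutive.toPerm (fun x : (ι → α) × α => (update x.1 i x.2, x.1 i)) ?_) _ _ ?_
    · intro x; simp
    · intro x; rfl
  rw [← univ_product_univ, expect_product, expect_product] at h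
  simpa using h

/-- Exchanging the `S`-coordinates of two independent uniform points is a measure-preserving
involution. -/
lemma expect_piecewise_swap (S : Finset ι) (F : (ι → α) → (ι → α) → ℝ) :
    𝔼 x, 𝔼 y, F (S.piecewise x y) (S.piecewise y x) = 𝔼 x, 𝔼 y, F x y := by
  rw [← expect_product' univ univ (fun x y => F (S.piecewise x y) (S.piecewise y x)),
    ← expect_product' univ univ (fun x y => F x y), univ_product_univ]
  refine Fintype.expect_equiv (Function.Involutive.toPerm
    (fun x : (ι → α) × (ι → α) => (S.piecewise x.1 x.2, S.piecewise x.2 x.1)) ?_) _ _ ?_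
  · intro x
    ext i <;> by_cases hi : i ∈ S <;> simp [hi]
  · intro x; rfl

lemma expect_piecewise (S : Finset ι) (F : (ι → α) → ℝ) :
    𝔼 x, 𝔼 y, F (S.piecewise x y) = 𝔼 x, F x := by
  simpa using expect_piecewise_swap S (fun x _ => F x)

lemma expect_prod (φ : ι → α → ℝ) : 𝔼 y : ι → α, ∏ i, φ i (y i) = ∏ i, 𝔼 c, φ i c := by
  simp_rw [Fintype.expect_eq_sum_div_card, Finset.prod_div_distrib]
  rw [Finset.prod_univ_sum]
  simp

/-! ### Product operators: noise, averaging and derivatives. -/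

/-- The kernel of the projection onto functions of mean zero. -/
noncomputable def meanZeroKernel (a b : α) : ℝ := if a = b then (Fintype.card α : ℝ) - 1 else -1

lemma meanZeroKernel_comm (a b : α) : meanZeroKernel a b = meanZeroKernel b a := by
  simp [meanZeroKernel, eq_comm]

lemma meanZeroKernel_eq (a b : α) :
    meanZeroKernel a b = (Fintype.card α : ℝ) * (if a = b then 1 else 0) - 1 := by
  by_cases h : a = b <;> simp [meanZeroKernel, h]

lemma card_pos_real : (0 : ℝ) < Fintype.card α := by exact_mod_cast Fintype.card_pos

lemma expect_delta_mul (a : α) (φ : α → ℝ) :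
    𝔼 c, ((Fintype.card α : ℝ) * (if a = c then 1 else 0)) * φ c = φ a := by
  rw [Fintype.expect_eq_sum_div_card]
  have := card_pos_real (α := α)
  simp [Finset.sum_ite_eq]

lemma expect_meanZeroKernel_mul (a : α) (φ : α → ℝ) :
    𝔼 c, meanZeroKernel a c * φ c = φ a - 𝔼 c, φ c := by
  simp_rw [meanZeroKernel_eq, sub_mul, expect_sub_distrib, expect_delta_mul, one_mul]

lemma expect_meanZeroKernel (a : α) : 𝔼 c, meanZeroKernel a c = 0 := by
  simpa using expect_meanZeroKernel_mul a (fun _ => (1 : ℝ))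

lemma expect_abs_meanZeroKernel_le (a : α) : 𝔼 c, |meanZeroKernel a c| ≤ 2 := by
  calc 𝔼 c, |meanZeroKernel a c|
      ≤ 𝔼 c, (((Fintype.card α : ℝ) * (if a = c then 1 else 0)) * 1 + 1) := by
        refine expect_le_expect fun c _ => ?_
        rw [meanZeroKernel_eq]
        have := card_pos_real (α := α)
        split_ifs <;> simp [abs_le]
        all_goals constructor <;> linarith
    _ = 2 := by
        rw [expect_add_distrib, expect_delta_mul a (fun _ => (1 : ℝ))]
        simp; norm_num

/-- Constants and mean-zero functions are complementary orthogonal eigenspaces, so composition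
multiplies the eigenvalues. This yields the multiplication rule `op_op`. -/
lemma expect_kernel_comp (a b a' b' : ℝ) (x z : α) :
    𝔼 y, (a + b * meanZeroKernel x y) * (a' + b' * meanZeroKernel y z)
      = a * a' + b * b' * meanZeroKernel x z := by
  have h : ∀ y, (a + b * meanZeroKernel x y) * (a' + b' * meanZeroKernel y z)
      = a * a' + a * b' * meanZeroKernel z y + b * a' * meanZeroKernel x y
        + b * b' * (meanZeroKernel x y * meanZeroKernel z y) := by
    intro y; rw [meanZeroKernel_comm y z]; ring
  simp_rw [h, expect_add_distrib, ← mul_expect, expect_meanZeroKernel,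
    expect_meanZeroKernel_mul, expect_meanZeroKernel]
  rw [meanZeroKernel_comm z x]
  simp

/-- The product operator acting on the coordinate `i` by `a i` on constants and by `b i` on
functions of mean zero. -/
noncomputable def op (a b : ι → ℝ) (f : (ι → α) → ℝ) (x : ι → α) : ℝ :=
  𝔼 y, (∏ i, (a i + b i * meanZeroKernel (x i) (y i))) * f y

lemma op_one (f : (ι → α) → ℝ) : op (fun _ => 1) (fun _ => 1) f = f := by
  ext x
  have h : ∀ y : ι → α, (∏ i, ((1 : ℝ) + 1 * meanZeroKernel (x i) (y i)))
      = (Fintype.card (ι → α) : ℝ) * (if x = y then 1 else 0) := by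
    intro y
    simp_rw [meanZeroKernel_eq, one_mul, add_sub_cancel]
    rw [Finset.prod_mul_distrib, Finset.prod_ite_zero]
    simp [funext_iff]
  simp_rw [op, h, expect_delta_mul]

lemma op_zero (f : (ι → α) → ℝ) (x : ι → α) : op (fun _ => 1) (fun _ => 0) f x = 𝔼 y, f y := by
  simp [op]

lemma op_op (a b a' b' : ι → ℝ) (f : (ι → α) → ℝ) :
    op a b (op a' b' f) = op (fun i => a i * a' i) (fun i => b i * b' i) f := by
  ext x
  simp_rw [op, mul_expect]
  rw [expect_comm]
  refine expect_congr rfl fun z _ => ?_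
  simp_rw [← mul_assoc, ← expect_mul, ← Finset.prod_mul_distrib]
  rw [expect_prod (fun i c => (a i + b i * meanZeroKernel (x i) c)
    * (a' i + b' i * meanZeroKernel c (z i)))]
  simp_rw [expect_kernel_comp]

lemma expect_mul_op (a b : ι → ℝ) (f g : (ι → α) → ℝ) :
    𝔼 x, g x * op a b f x = 𝔼 x, op a b g x * f x := by
  simp_rw [op, mul_expect, expect_mul]
  rw [expect_comm]
  refine expect_congr rfl fun y _ => expect_congr rfl fun x _ => ?_
  simp_rw [meanZeroKernel_comm (x _) (y _)]
  ring

lemma expect_op_sq (a b : ι → ℝ) (f : (ι → α) → ℝ) :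
    𝔼 x, op a b f x ^ 2 = 𝔼 x, f x * op (fun i => a i ^ 2) (fun i => b i ^ 2) f x := by
  simp_rw [pow_two, ← op_op]
  rw [← expect_mul_op]

lemma op_sub (a b : ι → ℝ) (f g : (ι → α) → ℝ) (x : ι → α) :
    op a b (fun y => f y - g y) x = op a b f x - op a b g x := by
  simp_rw [op, mul_sub, expect_sub_distrib]

lemma op_const (a b : ι → ℝ) (v : ℝ) (x : ι → α) :
    op a b (fun _ => v) x = (∏ i, a i) * v := by
  simp_rw [op, ← expect_mul]
  rw [expect_prod (fun i c => a i + b i * meanZeroKernel (x i) c)]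
  simp_rw [expect_add_distrib, ← mul_expect, expect_meanZeroKernel]
  simp

/-- Dependence of `op` on the parameters of one coordinate. -/
lemma op_update_coord (i : ι) (a b : ι → ℝ) (u v : ℝ) (f : (ι → α) → ℝ) (x : ι → α) :
    op (update a i u) (update b i v) f x
      = u * op (update a i 1) (update b i 0) f x + v * op (update a i 0) (update b i 1) f x := by
  simp_rw [op, mul_expect]
  rw [← expect_add_distrib]
  refine expect_congr rfl fun y _ => ?_
  simp_rw [fun u v : ℝ => (Fintype.prod_eq_mul_prod_compl i
    (fun j => update a i u j + update b i v j * meanZeroKernel (x j) (y j)))]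
  have h : ∀ u v : ℝ, ∏ j ∈ {i}ᶜ, (update a i u j + update b i v j * meanZeroKernel (x j) (y j))
      = ∏ j ∈ {i}ᶜ, (a j + b j * meanZeroKernel (x j) (y j)) := by
    intro u v
    refine prod_congr rfl fun j hj => ?_
    have : j ≠ i := by simpa using hj
    simp [this]
  simp_rw [h]
  simp
  ring

lemma expect_op_update (i : ι) (a b : ι → ℝ) (f : (ι → α) → ℝ) (x : ι → α) :
    𝔼 c, op a b f (update x i c) = op a (update b i 0) f x := by
  simp_rw [op]
  rw [expect_comm]
  refine expect_congr rfl fun y _ => ?_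
  rw [← expect_mul]
  congr 1
  simp_rw [fun c => (Fintype.prod_eq_mul_prod_compl i
    (fun j => a j + b j * meanZeroKernel (update x i c j) (y j)))]
  rw [Fintype.prod_eq_mul_prod_compl i]
  have h : ∀ c, ∏ j ∈ {i}ᶜ, (a j + b j * meanZeroKernel (update x i c j) (y j))
      = ∏ j ∈ {i}ᶜ, (a j + update b i 0 j * meanZeroKernel (x j) (y j)) := by
    intro c
    refine prod_congr rfl fun j hj => ?_
    have : j ≠ i := by simpa using hj
    simp [this]
  simp_rw [h, ← expect_mul]
  congr 1
  simp_rw [update_self, expect_add_distrib, ← mul_expect, fun c => meanZeroKernel_comm c (y i),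
    expect_meanZeroKernel]
  simp

/-! ### Noise stability and its level decomposition. -/

/-- The noise stability of `f` at correlation `t`. -/
noncomputable def stab (t : ℝ) (f : (ι → α) → ℝ) : ℝ :=
  𝔼 x, f x * op (fun _ => 1) (fun _ => t) f x

/-- The squared norm of the component of `f` depending on exactly the coordinates in `S`. -/
noncomputable def levelWeight (S : Finset ι) (f : (ι → α) → ℝ) : ℝ :=
  𝔼 x, f x * op (fun i => if i ∈ S then 0 else 1) (fun i => if i ∈ S then 1 else 0) f x

/-- The operator has eigenvalues 0 and 1, so it is a self-adjoint projection and the quadratic form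
is a squared norm. -/
lemma levelWeight_nonneg (S : Finset ι) (f : (ι → α) → ℝ) : 0 ≤ levelWeight S f := by
  have h := expect_op_sq (fun i => if i ∈ S then 0 else 1) (fun i => if i ∈ S then 1 else 0) f
  have h' : levelWeight S f = 𝔼 x, f x *
      op (fun i => (if i ∈ S then (0 : ℝ) else 1) ^ 2) (fun i => (if i ∈ S then 1 else 0) ^ 2) f x := by
    simp only [levelWeight, ite_pow]
    norm_num
  rw [h', ← h]
  exact expect_nonneg fun _ _ => sq_nonneg _

lemma levelWeight_empty (f : (ι → α) → ℝ) : levelWeight ∅ f = (𝔼 x, f x) ^ 2 := by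
  simp [levelWeight, op_zero, ← expect_mul, pow_two]

lemma op_ite_prod (S : Finset ι) (a b : ι → ℝ) (f : (ι → α) → ℝ) (x : ι → α) :
    op (fun i => if i ∈ S then 0 else a i) (fun i => if i ∈ S then b i else 0) f x
      = 𝔼 y, (∏ i ∈ S, b i * meanZeroKernel (x i) (y i)) * (∏ i ∈ Sᶜ, a i) * f y := by
  rw [op]
  refine expect_congr rfl fun y _ => ?_
  rw [← Finset.prod_mul_prod_compl S]
  congr 2
  · exact prod_congr rfl fun i hi => by simp [hi]
  · exact prod_congr rfl fun i hi => by simp [mem_compl.1 hi]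

/-- Expand the product of the kernels `1 + t * meanZeroKernel` over subsets of coordinates. -/
lemma stab_eq_sum (t : ℝ) (f : (ι → α) → ℝ) :
    stab t f = ∑ S : Finset ι, t ^ #S * levelWeight S f := by
  simp_rw [stab, levelWeight]
  simp_rw [mul_expect]
  rw [← expect_sum_comm]
  refine expect_congr rfl fun x _ => ?_
  simp_rw [mul_left_comm (_ ^ _) (f x), ← Finset.mul_sum]
  congr 1
  simp_rw [op_ite_prod _ (fun _ => (1 : ℝ)) (fun _ => (1 : ℝ)), op, mul_expect]
  rw [← expect_sum_comm]
  refine expect_congr rfl fun y _ => ?_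
  simp_rw [add_comm (1 : ℝ)]
  rw [Fintype.prod_add, Finset.sum_mul]
  refine sum_congr rfl fun S _ => ?_
  simp [Finset.prod_mul_distrib]
  ring

lemma stab_sub_sq_eq_sum (t : ℝ) (f : (ι → α) → ℝ) :
    stab t f - (𝔼 x, f x) ^ 2 = ∑ S ∈ univ.erase (∅ : Finset ι), t ^ #S * levelWeight S f := by
  rw [stab_eq_sum, ← Finset.add_sum_erase _ _ (mem_univ (∅ : Finset ι)), levelWeight_empty]
  simp

lemma sq_le_stab {t : ℝ} (ht : 0 ≤ t) (f : (ι → α) → ℝ) : (𝔼 x, f x) ^ 2 ≤ stab t f := by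
  rw [← sub_nonneg, stab_sub_sq_eq_sum]
  exact sum_nonneg fun S _ => mul_nonneg (pow_nonneg ht _) (levelWeight_nonneg _ _)

lemma stab_mono {t u : ℝ} (ht : 0 ≤ t) (htu : t ≤ u) (f : (ι → α) → ℝ) : stab t f ≤ stab u f := by
  rw [stab_eq_sum, stab_eq_sum]
  refine sum_le_sum fun S _ => ?_
  have := levelWeight_nonneg S f
  gcongr

/-- The variance part of the noise stability is at least linear in the correlation. -/
lemma stab_sub_sq_mul_le {c t : ℝ} (hc : 0 ≤ c) (hc1 : c ≤ 1) (ht : 0 ≤ t) (f : (ι → α) → ℝ) :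
    stab (c * t) f - (𝔼 x, f x) ^ 2 ≤ c * (stab t f - (𝔼 x, f x) ^ 2) := by
  rw [stab_sub_sq_eq_sum, stab_sub_sq_eq_sum, Finset.mul_sum]
  refine sum_le_sum fun S hS => ?_
  have hS' : #S ≠ 0 := by simpa using hS
  have := levelWeight_nonneg S f
  rw [mul_pow, ← mul_assoc]
  gcongr
  exact pow_le_of_le_one hc hc1 hS'

lemma stab_one (f : (ι → α) → ℝ) : stab 1 f = 𝔼 x, f x ^ 2 := by
  simp [stab, op_one, pow_two]

lemma expect_noise_sq (t : ℝ) (f : (ι → α) → ℝ) :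
    𝔼 x, op (fun _ => 1) (fun _ => t) f x ^ 2 = stab (t ^ 2) f := by
  rw [expect_op_sq]; simp [stab]

/-! ### Hypercontractivity with derivatives. -/

lemma one_add_pow_le_quadratic {s : ℕ} {u : ℝ} (hu : |s * u| ≤ 1) (hu1 : -1 ≤ u) :
    (1 + u) ^ s ≤ 1 + s * u + (s * u) ^ 2 := by
  have h1 : (1 + u) ^ s ≤ Real.exp (s * u) := by
    rw [Real.exp_nat_mul]
    exact pow_le_pow_left₀ (by linarith) (by linarith [Real.add_one_le_exp u]) s
  have h2 := (abs_le.1 (Real.abs_exp_sub_one_sub_id_le hu)).2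
  linarith

lemma pow_add_mul_le_add_pow {P X : ℝ} (hP : 0 ≤ P) (hX : 0 ≤ X) (n : ℕ) :
    P ^ (n + 1) + (n + 1) * P ^ n * X ≤ (P + X) ^ (n + 1) := by
  induction n with
  | zero => simp
  | succ n ih =>
    have h : 0 ≤ P ^ n := pow_nonneg hP n
    have h' : 0 ≤ (n + 1 : ℝ) * P ^ n * X * X := by positivity
    calc P ^ (n + 1 + 1) + ((n + 1 : ℕ) + 1) * P ^ (n + 1) * X
        ≤ (P ^ (n + 1) + (n + 1) * P ^ n * X) * (P + X) := by
          push_cast; ring_nf; ring_nf at h'; linarith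
      _ ≤ (P + X) ^ (n + 1) * (P + X) := by gcongr
      _ = _ := by ring

/-- Taylor-type bound behind the one-variable hypercontractive inequality. -/
lemma pow_perturb_le {n : ℕ} {A y t ρ : ℝ} (hρ : ρ = 1 / (4 * (n + 1))) (hA : 0 ≤ A) (hy : 0 ≤ y)
    (ht : |t| ≤ A * y) :
    (A ^ 2 + 2 * ρ * t + ρ ^ 2 * y ^ 2) ^ (n + 1) ≤
      (A ^ 2) ^ (n + 1) + (A ^ 2) ^ n * (t / 2) + (n + 1) * (A ^ 2) ^ n * y ^ 2
        + (y ^ 2) ^ (n + 1) := by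
  have hn : (0 : ℝ) < n + 1 := by positivity
  have hρ0 : 0 < ρ := by rw [hρ]; positivity
  have hsρ : (n + 1) * ρ = 1 / 4 := by rw [hρ]; field_simp
  have hρ1 : ρ ≤ 1 / 4 := by nlinarith [(Nat.cast_nonneg n : (0 : ℝ) ≤ n)]
  obtain ⟨ht1, ht2⟩ := abs_le.1 ht
  have hAn : 0 ≤ (A ^ 2) ^ n := by positivity
  -- Here `A` and `y` stand for the norms of the mean and of the deviation, and `t` for their inner
  -- product. For `y ≤ A` the relative perturbation `w / A ^ 2` is small enough for a second-order
  -- expansion; the choice of `ρ` turns the linear term into `t / 2`.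
  rcases le_or_gt y A with hyA | hyA
  · rcases hA.eq_or_lt with rfl | hA
    · obtain rfl : y = 0 := le_antisymm hyA hy
      have : t = 0 := by simpa using ht
      simp [this]
    set w := 2 * ρ * t + ρ ^ 2 * y ^ 2 with hw
    have hw1 : |w| ≤ 3 * ρ * (A * y) := by
      have h1 : ρ ^ 2 * y ^ 2 ≤ ρ * (A * y) := by
        have : ρ * y * (ρ * y) ≤ (1 * A) * (ρ * y) := by gcongr <;> nlinarith
        nlinarith
      have h2 : 0 ≤ ρ ^ 2 * y ^ 2 := by positivity
      rw [abs_le]; constructor <;> nlinarith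
    have hAy : A * y ≤ A ^ 2 := by nlinarith
    have hu : |((n + 1 : ℕ) : ℝ) * (w / A ^ 2)| ≤ 1 := by
      rw [abs_mul, abs_div, abs_of_pos (by positivity : (0 : ℝ) < A ^ 2), Nat.abs_cast]
      push_cast
      rw [mul_div_assoc', div_le_one (by positivity)]
      calc (n + 1 : ℝ) * |w| ≤ (n + 1) * (3 * ρ * (A * y)) := by gcongr
        _ = 3 * ((n + 1) * ρ) * (A * y) := by ring
        _ ≤ A ^ 2 := by rw [hsρ]; nlinarith
    have hu1 : -1 ≤ w / A ^ 2 := by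
      rw [le_div_iff₀ (by positivity)]
      have := (abs_le.1 hw1).1
      nlinarith [mul_nonneg hA.le hy]
    have key := one_add_pow_le_quadratic hu hu1
    have hw2 : ((n + 1) * w) ^ 2 ≤ (9 / 16) * (A ^ 2 * y ^ 2) := by
      have h3 : |(n + 1) * w| ≤ 3 / 4 * (A * y) := by
        rw [abs_mul, abs_of_pos hn]
        calc (n + 1 : ℝ) * |w| ≤ (n + 1) * (3 * ρ * (A * y)) := by gcongr
          _ = 3 * ((n + 1) * ρ) * (A * y) := by ring
          _ = _ := by rw [hsρ]; ring
      calc ((n + 1) * w) ^ 2 = |(n + 1) * w| ^ 2 := (sq_abs _).symm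
        _ ≤ (3 / 4 * (A * y)) ^ 2 := by gcongr
        _ = _ := by ring
    have hw3 : (n + 1) * w = t / 2 + ρ / 4 * y ^ 2 := by
      rw [hw]
      calc (n + 1) * (2 * ρ * t + ρ ^ 2 * y ^ 2)
          = 2 * ((n + 1) * ρ) * t + ((n + 1) * ρ) * ρ * y ^ 2 := by ring
        _ = _ := by rw [hsρ]; ring
    calc (A ^ 2 + 2 * ρ * t + ρ ^ 2 * y ^ 2) ^ (n + 1)
        = (A ^ 2) ^ (n + 1) * (1 + w / A ^ 2) ^ (n + 1) := by
          have e : A ^ 2 * (1 + w / A ^ 2) = A ^ 2 + w := by field_simp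
          rw [← mul_pow (A ^ 2), e, hw, add_assoc]
      _ ≤ (A ^ 2) ^ (n + 1) * (1 + ((n + 1 : ℕ) : ℝ) * (w / A ^ 2)
            + (((n + 1 : ℕ) : ℝ) * (w / A ^ 2)) ^ 2) := by gcongr
      _ = (A ^ 2) ^ n * (A ^ 2 + (n + 1) * w + ((n + 1) * w) ^ 2 / A ^ 2) := by
          push_cast; field_simp; ring
      _ ≤ (A ^ 2) ^ n * (A ^ 2 + (t / 2 + ρ / 4 * y ^ 2) + 9 / 16 * y ^ 2) := by
          rw [hw3] at hw2 ⊢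
          gcongr
          rw [div_le_iff₀ (by positivity)]
          linarith
      _ ≤ (A ^ 2) ^ n * (A ^ 2 + t / 2 + (n + 1) * y ^ 2) := by
          refine mul_le_mul_of_nonneg_left ?_ hAn
          have : 0 ≤ (n : ℝ) * y ^ 2 := by positivity
          nlinarith [sq_nonneg y]
      _ ≤ _ := by
          have : 0 ≤ (y ^ 2) ^ (n + 1) := by positivity
          rw [pow_succ (A ^ 2)]
          linarith
  · have h1 : A ^ 2 + 2 * ρ * t + ρ ^ 2 * y ^ 2 ≤ (A + ρ * y) ^ 2 := by nlinarith
    have h0 : 0 ≤ A ^ 2 + 2 * ρ * t + ρ ^ 2 * y ^ 2 := by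
      nlinarith [sq_nonneg (A - ρ * y)]
    have h2 : ((A + ρ * y) ^ 2) ^ (n + 1) ≤ (A ^ 2) ^ (n + 1) + (y ^ 2) ^ (n + 1) := by
      rcases le_or_gt (A + ρ * y) y with h | h
      · have : ((A + ρ * y) ^ 2) ^ (n + 1) ≤ (y ^ 2) ^ (n + 1) := by gcongr
        have : 0 ≤ (A ^ 2) ^ (n + 1) := by positivity
        linarith
      -- Now `A` lies between `(1 - ρ) * y` and `y`. Enlarging `A` to `A + ρ * y` at most doubles
      -- its power by Bernoulli, and the second copy is absorbed by the power of `y`.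
      · have h3 : 1 / 2 ≤ (1 - ρ) ^ (2 * (n + 1)) := by
          have := one_add_mul_le_pow (a := -ρ) (by linarith) (2 * (n + 1))
          push_cast at this
          have e : (1 : ℝ) + -ρ = 1 - ρ := by ring
          rw [e] at this
          nlinarith
        have h4 : ((1 - ρ) * (A + ρ * y)) ^ (2 * (n + 1)) ≤ A ^ (2 * (n + 1)) := by
          have : 0 ≤ 1 - ρ := by linarith
          gcongr
          nlinarith
        have h5 : A ^ (2 * (n + 1)) ≤ y ^ (2 * (n + 1)) := by gcongr
        rw [mul_pow] at h4
        rw [← pow_mul, ← pow_mul, ← pow_mul]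
        have h6 : 0 ≤ (A + ρ * y) ^ (2 * (n + 1)) := by positivity
        nlinarith
    have h3 : 0 ≤ (A ^ 2) ^ n * (t / 2 + (n + 1) * y ^ 2) := by
      refine mul_nonneg hAn ?_
      have : 0 ≤ (n : ℝ) * y ^ 2 := by positivity
      nlinarith
    calc _ ≤ ((A + ρ * y) ^ 2) ^ (n + 1) := by gcongr
      _ ≤ _ := by linarith


/-- One-variable hypercontractive inequality for functions with values in a Hilbert space. -/
lemma one_variable_hypercontractive {K : Type*} [Fintype K] {n : ℕ} {ρ : ℝ}
    (hρ : ρ = 1 / (4 * (n + 1))) (u : α → K → ℝ) (a : K → ℝ) (ha : ∀ k, a k = 𝔼 c, u c k) :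
    𝔼 c, (𝔼 k, (a k + ρ * (u c k - a k)) ^ 2) ^ (n + 1) ≤
      (𝔼 c, 𝔼 k, u c k ^ 2) ^ (n + 1) + 𝔼 c, (𝔼 k, (u c k - a k) ^ 2) ^ (n + 1) := by
  set P := 𝔼 k, a k ^ 2 with hP
  set Q : α → ℝ := fun c => 𝔼 k, (u c k - a k) ^ 2 with hQ
  set t : α → ℝ := fun c => 𝔼 k, a k * (u c k - a k) with ht
  have hP0 : 0 ≤ P := expect_nonneg fun _ _ => sq_nonneg _
  have hQ0 : ∀ c, 0 ≤ Q c := fun c => expect_nonneg fun _ _ => sq_nonneg _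
  have ht0 : 𝔼 c, t c = 0 := by
    simp only [ht]
    rw [expect_comm]
    refine expect_eq_zero fun k _ => ?_
    rw [← mul_expect, expect_sub_distrib, ← ha k]
    simp
  have hu : 𝔼 c, 𝔼 k, u c k ^ 2 = P + 𝔼 c, Q c := by
    have : ∀ c, 𝔼 k, u c k ^ 2 = P + 2 * t c + Q c := by
      intro c
      simp only [hP, ht, hQ]
      rw [mul_expect, ← expect_add_distrib, ← expect_add_distrib]
      exact expect_congr rfl fun k _ => by ring
    simp_rw [this, expect_add_distrib, ← mul_expect, ht0]
    simp
  have hexp : ∀ c, 𝔼 k, (a k + ρ * (u c k - a k)) ^ 2 = P + 2 * ρ * t c + ρ ^ 2 * Q c := by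
    intro c
    simp only [hP, ht, hQ]
    rw [mul_expect, mul_expect, ← expect_add_distrib, ← expect_add_distrib]
    exact expect_congr rfl fun k _ => by ring
  -- The bound is linear in `t c`, which averages to zero. The remaining `Q c` term is the
  -- first-order part of `(P + 𝔼 Q) ^ (n + 1)`.
  have hpt : ∀ c, (𝔼 k, (a k + ρ * (u c k - a k)) ^ 2) ^ (n + 1) ≤
      P ^ (n + 1) + P ^ n / 2 * t c + (n + 1) * P ^ n * Q c + Q c ^ (n + 1) := by
    intro c
    have hcs : t c ^ 2 ≤ P * Q c := expect_mul_sq_le_sq_mul_sq _ _ _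
    have := pow_perturb_le (n := n) (A := √P) (y := √(Q c)) (t := t c) hρ
      (Real.sqrt_nonneg _) (Real.sqrt_nonneg _)
      (by rw [← Real.sqrt_mul hP0]; exact Real.abs_le_sqrt hcs)
    rw [Real.sq_sqrt hP0, Real.sq_sqrt (hQ0 c)] at this
    rw [hexp]
    linarith
  calc _ ≤ 𝔼 c, (P ^ (n + 1) + P ^ n / 2 * t c + (n + 1) * P ^ n * Q c + Q c ^ (n + 1)) :=
        expect_le_expect fun c _ => hpt c
    _ = P ^ (n + 1) + (n + 1) * P ^ n * (𝔼 c, Q c) + 𝔼 c, Q c ^ (n + 1) := by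
        simp_rw [expect_add_distrib, ← mul_expect, ht0]
        simp
    _ ≤ _ := by
        rw [hu]
        have := pow_add_mul_le_add_pow hP0 (expect_nonneg fun c (_ : c ∈ univ) => hQ0 c) n
        linarith

/-- Noise outside `J`, projection to mean zero on `S`, identity elsewhere. -/
noncomputable def hybridOp (ρ : ℝ) (J S : Finset ι) (f : (ι → α) → ℝ) : (ι → α) → ℝ :=
  op (fun i => if i ∈ S then 0 else 1) (fun i => if i ∈ J then 1 else ρ) f

/-- Apply the one-variable inequality in coordinate `i`, with values in the `L²` space of the
variables `z`. Noise at `i` is mean plus `ρ` times deviation. In the first resulting term `i` joins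
the inner `L²` average; in the second it becomes a derivative coordinate and stays in the outer
average. -/
lemma hybrid_step {n : ℕ} {ρ : ℝ} (hρ : ρ = 1 / (4 * (n + 1))) (f : (ι → α) → ℝ)
    {J S : Finset ι} (hS : S ⊆ J) {i : ι} (hi : i ∉ J) :
    𝔼 x, (𝔼 z, hybridOp ρ J S f ((J \ S).piecewise z x) ^ 2) ^ (n + 1) ≤
      𝔼 x, (𝔼 z, hybridOp ρ (insert i J) S f ((insert i J \ S).piecewise z x) ^ 2) ^ (n + 1) +
      𝔼 x, (𝔼 z, hybridOp ρ (insert i J) (insert i S) f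
        ((insert i J \ insert i S).piecewise z x) ^ 2) ^ (n + 1) := by
  have hiS : i ∉ S := fun h => hi (hS h)
  set g := hybridOp ρ (insert i J) S f with hg
  set a : ι → ℝ := fun j => if j ∈ S then 0 else 1
  set b : ι → ℝ := fun j => if j ∈ J then 1 else ρ
  have ea : update a i 1 = a := by
    ext j; by_cases hj : j = i
    · subst hj; simp [a, hiS]
    · simp [hj]
  have eb : update b i ρ = b := by
    ext j; by_cases hj : j = i
    · subst hj; simp [b, hi]
    · simp [hj]
  have eg : g = op (update a i 1) (update b i 1) f := by
    rw [ea, hg, hybridOp]; congr 1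
    ext j; by_cases hj : j = i
    · subst hj; simp
    · simp [hj, b]
  have hE : ∀ x, 𝔼 c, g (update x i c) = op (update a i 1) (update b i 0) f x := by
    intro x; rw [eg, expect_op_update, update_idem]
  have hL : ∀ x, hybridOp ρ (insert i J) (insert i S) f x = g x - 𝔼 c, g (update x i c) := by
    intro x
    have : hybridOp ρ (insert i J) (insert i S) f = op (update a i 0) (update b i 1) f := by
      rw [hybridOp]; congr 1
      · ext j; by_cases hj : j = i
        · subst hj; simp
        · simp [hj, a]
      · ext j; by_cases hj : j = i
        · subst hj; simp
        · simp [hj, b]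
    rw [this, hE, eg, op_update_coord i a b 1 1]
    ring
  have hT : ∀ x, hybridOp ρ J S f x
      = (𝔼 c, g (update x i c)) + ρ * (g x - 𝔼 c, g (update x i c)) := by
    intro x
    have : hybridOp ρ J S f = op (update a i 1) (update b i ρ) f := by rw [ea, eb]; rfl
    rw [← hL, this, hE, op_update_coord i a b 1 ρ]
    have h2 : hybridOp ρ (insert i J) (insert i S) f = op (update a i 0) (update b i 1) f := by
      rw [hybridOp]; congr 1
      · ext j; by_cases hj : j = i
        · subst hj; simp
        · simp [hj, a]
      · ext j; by_cases hj : j = i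
        · subst hj; simp
        · simp [hj, b]
    rw [h2]; ring
  have hiJS : i ∉ J \ S := fun h => hi (mem_sdiff.1 h).1
  have eset1 : insert i J \ S = insert i (J \ S) := by rw [insert_sdiff_of_notMem _ hiS]
  have eset2 : insert i J \ insert i S = J \ S := by
    ext j; by_cases hj : j = i
    · subst hj; simp [hi]
    · simp [hj]
  rw [eset1, eset2]
  have hpw : ∀ (z x : ι → α) c, (J \ S).piecewise z (update x i c)
      = update ((J \ S).piecewise z x) i c := by
    intro z x c
    rw [Finset.update_piecewise_of_notMem _ _ _ hiJS]
  rw [← expect_update i, ← expect_update i (fun x => (𝔼 z,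
    hybridOp ρ (insert i J) (insert i S) f ((J \ S).piecewise z x) ^ 2) ^ (n + 1)),
    ← expect_add_distrib]
  refine expect_le_expect fun x _ => ?_
  have key := one_variable_hypercontractive hρ
    (fun c (z : ι → α) => g (update ((J \ S).piecewise z x) i c))
    (fun z => 𝔼 c, g (update ((J \ S).piecewise z x) i c)) (fun _ => rfl)
  have e1 : 𝔼 c, 𝔼 z : ι → α, g (update ((J \ S).piecewise z x) i c) ^ 2
      = 𝔼 z, g ((insert i (J \ S)).piecewise z x) ^ 2 := by
    rw [expect_comm, ← expect_update i (fun z => g ((insert i (J \ S)).piecewise z x) ^ 2)]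
    refine expect_congr rfl fun z _ => expect_congr rfl fun c _ => ?_
    congr 2
    ext j; by_cases hj : j = i
    · subst hj; simp
    · by_cases hj' : j ∈ J \ S <;> simp [hj, hj', Finset.piecewise]
  rw [e1] at key
  simp_rw [hT, hL, hpw, update_idem]
  exact key

/-- Hypercontractive inequality: the noise operator with parameter `1 / (4 (n + 1))` maps into
`L^(2 (n + 1))` with norm controlled by the two-norms of the derivatives of `f`. -/
lemma hypercontractive {n : ℕ} {ρ : ℝ} (hρ : ρ = 1 / (4 * (n + 1))) (f : (ι → α) → ℝ) :
    𝔼 x, (op (fun _ => 1) (fun _ => ρ) f x ^ 2) ^ (n + 1) ≤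
      ∑ S : Finset ι, 𝔼 x, (𝔼 z,
        op (fun i => if i ∈ S then 0 else 1) (fun _ => 1) f (S.piecewise x z) ^ 2) ^ (n + 1) := by
  -- `J` collects the coordinates whose noise has been removed; each of them has been assigned
  -- either to the derivative set `S` or to the inner average.
  have key : ∀ J : Finset ι, 𝔼 x, (op (fun _ => 1) (fun _ => ρ) f x ^ 2) ^ (n + 1) ≤
      ∑ S ∈ J.powerset, 𝔼 x, (𝔼 z, hybridOp ρ J S f ((J \ S).piecewise z x) ^ 2) ^ (n + 1) := by
    intro J
    induction J using Finset.induction_on with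
    | empty =>
      have h : ∀ z x : ι → α, ((∅ : Finset ι) \ ∅).piecewise z x = x := by
        intro z x; ext j; simp [Finset.piecewise]
      simp only [powerset_empty, sum_singleton, h, expect_const univ_nonempty, hybridOp, notMem_empty,
        if_false]
      exact le_rfl
    | insert i J hi ih =>
      refine ih.trans ?_
      rw [sum_powerset_insert hi, ← sum_add_distrib]
      exact sum_le_sum fun S hS => hybrid_step hρ f (mem_powerset.1 hS) hi
  refine (key univ).trans (le_of_eq ?_)
  rw [powerset_univ]
  refine sum_congr rfl fun S _ => expect_congr rfl fun x _ => ?_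
  have h : ∀ z : ι → α, (univ \ S).piecewise z x = S.piecewise x z := by
    intro z; ext j; by_cases hj : j ∈ S <;> simp [Finset.piecewise, hj]
  simp only [h, hybridOp, mem_univ, if_true]

/-! ### Restrictions and derivatives. -/

/-- The restriction of `f` obtained by fixing the coordinates in `S` to `b`. -/
def restr (S : Finset ι) (b : ι → α) (f : (ι → α) → ℝ) (y : ι → α) : ℝ := f (S.piecewise b y)

lemma restr_empty (b : ι → α) (f : (ι → α) → ℝ) : restr ∅ b f = f := by
  ext y; simp [restr]

lemma restr_restr (S T : Finset ι) (b c : ι → α) (f : (ι → α) → ℝ) :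
    restr T c (restr S b f) = restr (S ∪ T) (S.piecewise b c) f := by
  ext y
  simp only [restr]
  congr 1
  ext i
  by_cases h1 : i ∈ S <;> by_cases h2 : i ∈ T <;> simp [h1, h2, Finset.piecewise]

/-- A noisy derivative is a signed average of noisy restrictions: the kernel on `S` becomes the
weight of `b`. The extra noise on `S` at the right is harmless, because `restr S b f` ignores those
coordinates and the noise kernel has mean one. -/
lemma op_piecewise (S : Finset ι) (σ : ℝ) (f : (ι → α) → ℝ) (x z : ι → α) :
    op (fun i => if i ∈ S then 0 else 1) (fun _ => σ) f (S.piecewise x z)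
      = 𝔼 b, (∏ i ∈ S, σ * meanZeroKernel (x i) (b i)) *
          op (fun _ => 1) (fun _ => σ) (restr S b f) z := by
  have h := expect_piecewise_swap S (fun w w' : ι → α =>
    (∏ i ∈ S, σ * meanZeroKernel (x i) (w i)) * (∏ i ∈ Sᶜ, (1 + σ * meanZeroKernel (z i) (w i)))
      * f w * ∏ i ∈ S, (1 + σ * meanZeroKernel (z i) (w' i)))
  have hone : 𝔼 w' : ι → α, ∏ i ∈ S, (1 + σ * meanZeroKernel (z i) (w' i)) = 1 := by
    have := expect_prod (fun (i : ι) (c : α) => if i ∈ S then 1 + σ * meanZeroKernel (z i) c else 1)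
    simp only [Finset.prod_ite_mem, univ_inter] at this
    rw [this]
    refine prod_eq_one fun i _ => ?_
    split_ifs
    · simp [expect_add_distrib, ← mul_expect, expect_meanZeroKernel]
    · simp
  simp_rw [← mul_expect, hone, mul_one] at h
  rw [op]
  trans 𝔼 y, ((∏ i ∈ S, σ * meanZeroKernel (x i) (y i)) *
    (∏ i ∈ Sᶜ, (1 + σ * meanZeroKernel (z i) (y i))) * f y)
  · refine expect_congr rfl fun y _ => ?_
    rw [← Finset.prod_mul_prod_compl S]
    congr 2
    · exact prod_congr rfl fun i hi => by simp [hi]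
    · exact prod_congr rfl fun i hi => by simp [mem_compl.1 hi]
  rw [← h]
  refine expect_congr rfl fun b _ => ?_
  rw [op, mul_expect]
  refine expect_congr rfl fun y _ => ?_
  have e1 : ∏ i ∈ S, σ * meanZeroKernel (x i) (S.piecewise b y i)
      = ∏ i ∈ S, σ * meanZeroKernel (x i) (b i) :=
    prod_congr rfl fun i hi => by simp [hi]
  have e2 : ∏ i ∈ Sᶜ, (1 + σ * meanZeroKernel (z i) (S.piecewise b y i))
      = ∏ i ∈ Sᶜ, (1 + σ * meanZeroKernel (z i) (y i)) :=
    prod_congr rfl fun i hi => by simp [mem_compl.1 hi]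
  have e3 : ∏ i ∈ S, (1 + σ * meanZeroKernel (z i) (S.piecewise y b i))
      = ∏ i ∈ S, (1 + σ * meanZeroKernel (z i) (y i)) :=
    prod_congr rfl fun i hi => by simp [hi]
  rw [e1, e2, e3, ← Finset.prod_mul_prod_compl S (fun i => 1 + σ * meanZeroKernel (z i) (y i))]
  simp only [restr]
  ring

/-- Cauchy–Schwarz with respect to `|ν|`, because the weights produced by `op_piecewise` are signed.
-/
lemma expect_mul_sq_le_abs {Ω : Type*} [Fintype Ω] (ν G : Ω → ℝ) :
    (𝔼 b, ν b * G b) ^ 2 ≤ (𝔼 b, |ν b|) * 𝔼 b, |ν b| * G b ^ 2 := by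
  have h1 : |𝔼 b, ν b * G b| ≤ 𝔼 b, √|ν b| * (√|ν b| * |G b|) := by
    refine (abs_expect_le _ _).trans (le_of_eq (expect_congr rfl fun b _ => ?_))
    rw [abs_mul, ← mul_assoc, Real.mul_self_sqrt (abs_nonneg _)]
  have h2 := expect_mul_sq_le_sq_mul_sq univ (fun b => √|ν b|) (fun b => √|ν b| * |G b|)
  simp_rw [mul_pow, Real.sq_sqrt (abs_nonneg _), sq_abs] at h2
  calc (𝔼 b, ν b * G b) ^ 2 = |𝔼 b, ν b * G b| ^ 2 := (sq_abs _).symm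
    _ ≤ (𝔼 b, √|ν b| * (√|ν b| * |G b|)) ^ 2 := by gcongr
    _ ≤ _ := h2

/-- Derivatives of the noise operator are controlled by the stability of restrictions. -/
lemma expect_derivative_sq_le {σ C : ℝ} (hσ : 0 ≤ σ) (S : Finset ι) (f : (ι → α) → ℝ)
    (hC : ∀ b, stab (σ ^ 2) (restr S b f) ≤ C) (x : ι → α) :
    𝔼 z, op (fun i => if i ∈ S then 0 else 1) (fun _ => σ) f (S.piecewise x z) ^ 2
      ≤ (4 * σ ^ 2) ^ #S * C := by
  set ν : (ι → α) → ℝ := fun b => ∏ i ∈ S, σ * meanZeroKernel (x i) (b i) with hν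
  have hν1 : 𝔼 b, |ν b| ≤ (2 * σ) ^ #S := by
    have h := expect_prod (fun (i : ι) (c : α) =>
      if i ∈ S then |σ * meanZeroKernel (x i) c| else 1)
    simp only [Finset.prod_ite_mem, univ_inter] at h
    simp_rw [hν, Finset.abs_prod]
    rw [h]
    have h2 : ∀ i, (𝔼 c, if i ∈ S then |σ * meanZeroKernel (x i) c| else 1)
        ≤ if i ∈ S then 2 * σ else 1 := by
      intro i
      split_ifs
      · simp_rw [abs_mul, ← mul_expect, abs_of_nonneg hσ]
        have := expect_abs_meanZeroKernel_le (x i)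
        nlinarith
      · simp
    calc _ ≤ ∏ i, (if i ∈ S then 2 * σ else 1) := by
          refine prod_le_prod (fun i _ => expect_nonneg fun c _ => ?_) fun i _ => h2 i
          split_ifs <;> positivity
      _ = _ := by rw [Finset.prod_ite_mem, univ_inter, prod_const]
  have hν0 : 0 ≤ 𝔼 b, |ν b| := expect_nonneg fun _ _ => abs_nonneg _
  have hC0 : 0 ≤ C := by
    refine le_trans ?_ (hC x)
    rw [← expect_noise_sq]
    exact expect_nonneg fun _ _ => sq_nonneg _
  simp_rw [op_piecewise]
  calc _ ≤ 𝔼 z, (𝔼 b, |ν b|) * 𝔼 b, |ν b| * op (fun _ => 1) (fun _ => σ) (restr S b f) z ^ 2 :=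
        expect_le_expect fun z _ => expect_mul_sq_le_abs _ _
    _ = (𝔼 b, |ν b|) * 𝔼 b, |ν b| * stab (σ ^ 2) (restr S b f) := by
        rw [← mul_expect, expect_comm]
        simp_rw [← mul_expect, expect_noise_sq]
    _ ≤ (𝔼 b, |ν b|) * 𝔼 b, |ν b| * C := by
        refine mul_le_mul_of_nonneg_left (expect_le_expect fun b _ => ?_) hν0
        exact mul_le_mul_of_nonneg_left (hC b) (abs_nonneg _)
    _ = (𝔼 b, |ν b|) ^ 2 * C := by rw [← expect_mul]; ring
    _ ≤ ((2 * σ) ^ #S) ^ 2 * C := by gcongr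
    _ = _ := by
        rw [← pow_mul, mul_comm #S 2, pow_mul]
        congr 2
        ring

/-- Split `1 + 2 * σ ^ 2 * κ` as `σ ^ 2 * κ + (1 + σ ^ 2 * κ)` in each coordinate, with `κ` the
mean-zero kernel, and expand over subsets. Summing the energies of all derivatives thus only doubles
the correlation. -/
lemma sum_expect_derivative_sq (σ : ℝ) (f : (ι → α) → ℝ) :
    ∑ S : Finset ι, 𝔼 x, op (fun i => if i ∈ S then 0 else 1) (fun _ => σ) f x ^ 2
      = stab (2 * σ ^ 2) f := by
  simp_rw [expect_op_sq, stab]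
  rw [← expect_sum_comm]
  refine expect_congr rfl fun x _ => ?_
  rw [← Finset.mul_sum]
  congr 1
  simp_rw [op]
  rw [← expect_sum_comm]
  refine expect_congr rfl fun y _ => ?_
  rw [← Finset.sum_mul]
  congr 1
  have h : ∀ i, 1 + 2 * σ ^ 2 * meanZeroKernel (x i) (y i)
      = σ ^ 2 * meanZeroKernel (x i) (y i) + (1 + σ ^ 2 * meanZeroKernel (x i) (y i)) := by
    intro i; ring
  simp_rw [h]
  rw [Fintype.prod_add]
  refine sum_congr rfl fun S _ => ?_
  rw [← Finset.prod_mul_prod_compl S]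
  congr 1
  · exact prod_congr rfl fun i hi => by simp [hi]
  · exact prod_congr rfl fun i hi => by simp [mem_compl.1 hi]

/-- Jensen for an even power under the probability density proportional to `f`; then `f ≤ 1` removes
the weight. -/
lemma expect_mul_pow_le {Ω : Type*} [Fintype Ω] [Nonempty Ω] (n : ℕ) (f G : Ω → ℝ)
    (h0 : ∀ x, 0 ≤ f x) (h1 : ∀ x, f x ≤ 1) :
    (𝔼 x, f x * G x) ^ (2 * (n + 1)) ≤ (𝔼 x, f x) ^ (2 * n + 1) * 𝔼 x, (G x ^ 2) ^ (n + 1) := by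
  rcases (expect_nonneg fun x (_ : x ∈ univ) => h0 x).eq_or_lt with h | h
  · have hf : f = 0 := (Fintype.expect_eq_zero_iff_of_nonneg h0).1 h.symm
    simp [hf]
  set N : ℝ := (Fintype.card Ω : ℝ) with hN
  have hN0 : 0 < N := by rw [hN]; exact_mod_cast Fintype.card_pos
  have hw : ∑ x, f x / (N * 𝔼 x, f x) = 1 := by
    rw [← Finset.sum_div, hN, Fintype.card_mul_expect, div_self]
    have := Fintype.card_mul_expect f
    rw [← this]; positivity
  have key := Real.pow_arith_mean_le_arith_mean_pow_of_even univ (fun x => f x / (N * 𝔼 x, f x)) G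
    (fun x _ => div_nonneg (h0 x) (by positivity)) hw (n := 2 * (n + 1)) (by simp)
  have e1 : ∀ H : Ω → ℝ, ∑ x, f x / (N * 𝔼 x, f x) * H x = (𝔼 x, f x * H x) / 𝔼 x, f x := by
    intro H
    rw [Fintype.expect_eq_sum_div_card (fun x => f x * H x), div_div, Finset.sum_div]
    exact sum_congr rfl fun x _ => by rw [div_mul_eq_mul_div]
  rw [e1, e1, div_pow, div_le_div_iff₀ (by positivity) h] at key
  have e2 : 2 * (n + 1) = (2 * n + 1) + 1 := by ring
  rw [e2, pow_succ (𝔼 x, f x), ← mul_assoc, mul_le_mul_iff_left₀ h, ← e2] at key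
  refine key.trans ?_
  rw [mul_comm]
  refine mul_le_mul_of_nonneg_left (expect_le_expect fun x _ => ?_) (by positivity)
  rw [pow_mul]
  exact mul_le_of_le_one_left (by positivity) (h1 x)

/-! ### Noise stability of global functions. -/

/-- Fixing any set `T` of coordinates gives a function of mean at most `M ^ |T| * η`. -/
def IsGlobal (M η : ℝ) (f : (ι → α) → ℝ) : Prop :=
  ∀ (T : Finset ι) (b : ι → α), 𝔼 x, restr T b f x ≤ M ^ #T * η

lemma IsGlobal.expect_le {M η : ℝ} {f : (ι → α) → ℝ} (hf : IsGlobal M η f) : 𝔼 x, f x ≤ η := by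
  have := hf ∅ (fun _ => Classical.arbitrary α)
  simpa [restr_empty] using this

lemma IsGlobal.restr {M η : ℝ} {f : (ι → α) → ℝ} (hM : 1 ≤ M) (hη : 0 ≤ η) (hf : IsGlobal M η f)
    (S : Finset ι) (b : ι → α) : IsGlobal M (M ^ #S * η) (restr S b f) := by
  intro T c
  rw [restr_restr]
  refine (hf _ _).trans ?_
  rw [← mul_assoc, ← pow_add, add_comm]
  gcongr
  exact card_union_le _ _

/-- The closing step of a bootstrap: the unknown `V` occurs on the right of `hV` to lower effective
order. If `V > δ * η ^ 2`, each of the two terms there is below half of the left side; `ε ≤ η`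
converts the absolute bounds `h1`, `h2` into ones relative to `η`. -/
lemma le_of_pow_le_aux {n : ℕ} {V η δ ε τ β : ℝ} (hε : 0 < ε) (hη : ε ≤ η) (hδ : 0 < δ)
    (hτ : 0 ≤ τ) (hβ : 0 ≤ β)
    (h1 : τ ^ (n + 1) ≤ δ ^ (n + 1) * ε / 2) (h2 : τ * β ^ n ≤ δ ^ (2 * n + 1) * ε / 2)
    (hV : V ^ (2 * (n + 1)) ≤ η ^ (2 * n + 1) * ((τ * V) ^ (n + 1) + (β * η ^ 2) ^ n * (τ * V))) :
    V ≤ δ * η ^ 2 := by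
  by_contra! h
  have hη0 : 0 < η := hε.trans_le hη
  have hV0 : 0 < V := lt_trans (by positivity) h
  have k1 : 2 * (η ^ (2 * n + 1) * τ ^ (n + 1)) < V ^ (n + 1) := by
    calc 2 * (η ^ (2 * n + 1) * τ ^ (n + 1)) ≤ 2 * (η ^ (2 * n + 1) * (δ ^ (n + 1) * η / 2)) := by
          gcongr
          exact h1.trans (by gcongr)
      _ = (δ * η ^ 2) ^ (n + 1) := by ring
      _ < V ^ (n + 1) := by gcongr
  have k2 : 2 * (η ^ (4 * n + 1) * (τ * β ^ n)) < V ^ (2 * n + 1) := by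
    calc 2 * (η ^ (4 * n + 1) * (τ * β ^ n))
        ≤ 2 * (η ^ (4 * n + 1) * (δ ^ (2 * n + 1) * η / 2)) := by
          gcongr
          exact h2.trans (by gcongr)
      _ = (δ * η ^ 2) ^ (2 * n + 1) := by ring
      _ < V ^ (2 * n + 1) := by gcongr
  have k1' := mul_lt_mul_of_pos_right k1 (pow_pos hV0 (n + 1))
  have k2' := mul_lt_mul_of_pos_right k2 hV0
  have e1 : V ^ (n + 1) * V ^ (n + 1) = V ^ (2 * (n + 1)) := by ring
  have e2 : V ^ (2 * n + 1) * V = V ^ (2 * (n + 1)) := by ring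
  have e3 : η ^ (2 * n + 1) * ((τ * V) ^ (n + 1) + (β * η ^ 2) ^ n * (τ * V))
      = η ^ (2 * n + 1) * τ ^ (n + 1) * V ^ (n + 1) + η ^ (4 * n + 1) * (τ * β ^ n) * V := by ring
  rw [e3] at hV
  rw [e1] at k1'
  rw [e2] at k2'
  linarith

/-- If the restrictions of `f` have small noise stability, so does `f`. -/
lemma stab_sub_sq_le_of_restr {n : ℕ} {lam σ τ M η δ ε : ℝ} (hlam : 0 ≤ lam)
    (hσ : σ = 4 * (n + 1) * lam) (hτ : τ = 32 * (n + 1) ^ 2 * lam) (hτ1 : τ ≤ 1)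
    (hM : 1 ≤ M) (hσM : 4 * σ ^ 2 * M ^ 2 ≤ 1) (hε : 0 < ε) (hη : ε ≤ η) (hδ : 0 < δ)
    (h1 : τ ^ (n + 1) ≤ δ ^ (n + 1) * ε / 2)
    (h2 : τ * (8 * σ ^ 2 * M ^ 2) ^ n ≤ δ ^ (2 * n + 1) * ε / 2)
    {f : (ι → α) → ℝ} (hf0 : ∀ x, 0 ≤ f x) (hf1 : ∀ x, f x ≤ 1) (hfη : 𝔼 x, f x ≤ η)
    (hf : ∀ S : Finset ι, S.Nonempty → ∀ b, stab (σ ^ 2) (restr S b f) ≤ 2 * (M ^ #S * η) ^ 2) :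
    stab lam f - (𝔼 x, f x) ^ 2 ≤ δ * η ^ 2 := by
  set μ := 𝔼 x, f x with hμ
  set V := stab lam f - μ ^ 2 with hV
  have hσ0 : 0 ≤ σ := by rw [hσ]; positivity
  have hτ0 : 0 ≤ τ := by rw [hτ]; positivity
  have hη0 : 0 < η := hε.trans_le hη
  have hμ0 : 0 ≤ μ := expect_nonneg fun x _ => hf0 x
  have hV0 : 0 ≤ V := sub_nonneg.2 (sq_le_stab hlam f)
  have h2σ : 2 * σ ^ 2 = τ * lam := by rw [hσ, hτ]; ring
  have hV2 : stab (2 * σ ^ 2) f - μ ^ 2 ≤ τ * V := by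
    rw [h2σ]; exact stab_sub_sq_mul_le hτ0 hτ1 hlam f
  have hV1 : stab (σ ^ 2) f - μ ^ 2 ≤ τ * V :=
    le_trans (sub_le_sub_right (stab_mono (by positivity) (by nlinarith [sq_nonneg σ]) f) _) hV2
  -- The noise `lam = ρ * σ` is split: `ρ` is spent on hypercontractivity, while `σ` stays in `g`
  -- and damps its derivatives.
  set ρ : ℝ := 1 / (4 * (n + 1)) with hρ
  have hρσ : ρ * σ = lam := by rw [hρ, hσ]; field_simp
  set g : (ι → α) → ℝ := op (fun _ => 1) (fun _ => σ) (fun y => f y - μ) with hg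
  have hder : ∀ (S : Finset ι) x, op (fun i => if i ∈ S then 0 else 1) (fun _ => 1) g x
      = op (fun i => if i ∈ S then 0 else 1) (fun _ => σ) f x - (if S = ∅ then μ else 0) := by
    intro S x
    rw [hg, op_op]
    simp only [mul_one, one_mul]
    rw [op_sub, op_const]
    congr 1
    split_ifs with h
    · simp [h]
    · obtain ⟨i, hi⟩ := nonempty_iff_ne_empty.2 h
      rw [prod_eq_zero (mem_univ i) (by simp [hi]), zero_mul]
  have hTg : ∀ x, op (fun _ => 1) (fun _ => ρ) g x = op (fun _ => 1) (fun _ => lam) f x - μ := by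
    intro x
    rw [hg, op_op]
    simp only [mul_one, hρσ]
    rw [op_sub, op_const]
    simp
  have hVf : V = 𝔼 x, f x * op (fun _ => 1) (fun _ => ρ) g x := by
    simp_rw [hTg, mul_sub, expect_sub_distrib, ← expect_mul]
    rw [hV, stab, pow_two]
  have hderiv : ∀ S : Finset ι, S.Nonempty → ∀ x, 𝔼 z,
      op (fun i => if i ∈ S then 0 else 1) (fun _ => σ) f (S.piecewise x z) ^ 2
        ≤ 8 * σ ^ 2 * M ^ 2 * η ^ 2 := by
    intro S hS x
    refine (expect_derivative_sq_le hσ0 S f (hf S hS) x).trans ?_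
    have e : (4 * σ ^ 2) ^ #S * (2 * (M ^ #S * η) ^ 2) = (4 * σ ^ 2 * M ^ 2) ^ #S * (2 * η ^ 2) := by
      rw [mul_pow (4 * σ ^ 2)]; ring
    rw [e]
    calc _ ≤ (4 * σ ^ 2 * M ^ 2) * (2 * η ^ 2) := by
          gcongr
          exact pow_le_of_le_one (by positivity) hσM hS.card_pos.ne'
      _ = _ := by ring
  refine le_of_pow_le_aux hε hη hδ hτ0 (by positivity) h1 h2 ?_
  have hyp := hypercontractive (n := n) hρ g
  have hsum : ∑ S : Finset ι, 𝔼 x, (𝔼 z,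
      op (fun i => if i ∈ S then 0 else 1) (fun _ => 1) g (S.piecewise x z) ^ 2) ^ (n + 1)
      ≤ (τ * V) ^ (n + 1) + (8 * σ ^ 2 * M ^ 2 * η ^ 2) ^ n * (τ * V) := by
    rw [← Finset.add_sum_erase _ _ (mem_univ (∅ : Finset ι))]
    refine add_le_add ?_ ?_
    · have e : 𝔼 z, (op (fun _ => 1) (fun _ => σ) f z - μ) ^ 2 = stab (σ ^ 2) f - μ ^ 2 := by
        have h3 : 𝔼 z, op (fun _ => 1) (fun _ => σ) f z = μ := by
          have := expect_mul_op (fun _ => 1) (fun _ => σ) f (fun _ => (1 : ℝ))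
          simpa [op_const] using this
        simp_rw [sub_sq, expect_add_distrib, expect_sub_distrib, expect_noise_sq, ← expect_mul,
          ← mul_expect, h3]
        simp; ring
      have h4 : ∀ (x z : ι → α), (∅ : Finset ι).piecewise x z = z := by
        intro x z; ext j; simp
      have h0 : ∀ z, op (fun _ => 1) (fun _ => 1) g z = op (fun _ => 1) (fun _ => σ) f z - μ := by
        intro z
        simpa using hder ∅ z
      simp only [h4, h0, notMem_empty, if_false]
      rw [e, expect_const univ_nonempty]
      have : 0 ≤ stab (σ ^ 2) f - μ ^ 2 := sub_nonneg.2 (sq_le_stab (by positivity) f)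
      gcongr
    -- Of the `n + 1` factors, `n` are bounded uniformly by `hderiv`; the last is kept and summed
    -- exactly over `S`.
    · have e : ∀ S ∈ univ.erase (∅ : Finset ι), 𝔼 x, (𝔼 z,
          op (fun i => if i ∈ S then 0 else 1) (fun _ => 1) g (S.piecewise x z) ^ 2) ^ (n + 1)
          ≤ (8 * σ ^ 2 * M ^ 2 * η ^ 2) ^ n *
            𝔼 x, op (fun i => if i ∈ S then 0 else 1) (fun _ => σ) f x ^ 2 := by
        intro S hS
        have hS' : S ≠ ∅ := by simpa using hS
        simp only [hder, hS', if_false, sub_zero]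
        rw [← expect_piecewise S (fun x => op (fun i => if i ∈ S then 0 else 1) (fun _ => σ) f x ^ 2),
          mul_expect]
        refine expect_le_expect fun x _ => ?_
        rw [pow_succ]
        have h5 : 0 ≤ 𝔼 z,
          op (fun i => if i ∈ S then 0 else 1) (fun _ => σ) f (S.piecewise x z) ^ 2 :=
            expect_nonneg fun _ _ => sq_nonneg _
        gcongr
        exact hderiv S (nonempty_iff_ne_empty.2 hS') x
      refine (sum_le_sum e).trans ?_
      rw [← Finset.mul_sum]
      gcongr
      refine le_trans ?_ hV2
      rw [← sum_expect_derivative_sq, ← Finset.add_sum_erase _ _ (mem_univ (∅ : Finset ι))]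
      -- The omitted empty-set term accounts for `μ ^ 2`, so the other derivatives are charged only
      -- to the variance part.
      have h6 : μ ^ 2 ≤ 𝔼 x : ι → α, op (fun i => if i ∈ (∅ : Finset ι) then 0 else 1)
          (fun _ => σ) f x ^ 2 := by
        simp only [notMem_empty, if_false, expect_noise_sq]
        exact sq_le_stab (by positivity) f
      linarith
  calc V ^ (2 * (n + 1))
      ≤ μ ^ (2 * n + 1) * 𝔼 x, (op (fun _ => 1) (fun _ => ρ) g x ^ 2) ^ (n + 1) := by
        rw [hVf]; exact expect_mul_pow_le n f _ hf0 hf1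
    _ ≤ η ^ (2 * n + 1) * ((τ * V) ^ (n + 1) + (8 * σ ^ 2 * M ^ 2 * η ^ 2) ^ n * (τ * V)) := by
        refine mul_le_mul (by gcongr) (hyp.trans hsum)
          (expect_nonneg fun _ _ => by positivity) (by positivity)

/-- Global functions have noise stability close to the square of their mean. -/
theorem IsGlobal.stab_sub_sq_le {n : ℕ} {lam σ τ M η δ ε : ℝ} (hlam : 0 ≤ lam)
    (hσ : σ = 4 * (n + 1) * lam) (hτ : τ = 32 * (n + 1) ^ 2 * lam) (hτ1 : τ ≤ 1)
    (hM : 1 < M) (hσM : 4 * σ ^ 2 * M ^ 2 ≤ 1) (hε : 0 < ε) (hη : ε ≤ η) (hδ : 0 < δ)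
    (hδ1 : δ ≤ 1) (hlamδ : lam ≤ δ)
    (h1 : τ ^ (n + 1) ≤ δ ^ (n + 1) * ε / 2)
    (h2 : τ * (8 * σ ^ 2 * M ^ 2) ^ n ≤ δ ^ (2 * n + 1) * ε / 2)
    {f : (ι → α) → ℝ} (hf0 : ∀ x, 0 ≤ f x) (hf1 : ∀ x, f x ≤ 1) (hf : IsGlobal M η f) :
    stab lam f - (𝔼 x, f x) ^ 2 ≤ δ * η ^ 2 := by
  -- Induct on the number of factors `M` separating `η` from 1. A nonempty restriction multiplies
  -- `η` by at least `M`, so the hypothesis applies to it; once `η ≥ 1`, the trivial variance bound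
  -- `lam ≤ δ` suffices.
  have key : ∀ (u : ℕ) (η : ℝ) (f : (ι → α) → ℝ), 1 ≤ M ^ u * η → ε ≤ η → (∀ x, 0 ≤ f x) →
      (∀ x, f x ≤ 1) → IsGlobal M η f → stab lam f - (𝔼 x, f x) ^ 2 ≤ δ * η ^ 2 := by
    intro u
    induction u with
    | zero =>
      intro η f hu hη hf0 hf1 hf
      have h3 := stab_sub_sq_mul_le hlam (hlamδ.trans hδ1) zero_le_one f
      rw [mul_one, stab_one] at h3
      have h4 : 𝔼 x, f x ^ 2 ≤ 1 := by
        refine Finset.expect_le univ_nonempty fun x _ => ?_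
        exact pow_le_one₀ (hf0 x) (hf1 x)
      have h5 : (1 : ℝ) ≤ η ^ 2 := one_le_pow₀ (by simpa using hu)
      have h6 := sq_nonneg (𝔼 x, f x)
      calc _ ≤ lam * (𝔼 x, f x ^ 2 - (𝔼 x, f x) ^ 2) := h3
        _ ≤ lam * 1 := by gcongr; linarith
        _ ≤ δ * η ^ 2 := by rw [mul_one]; nlinarith
    | succ u ih =>
      intro η f hu hη hf0 hf1 hf
      have hη0 : 0 < η := hε.trans_le hη
      refine stab_sub_sq_le_of_restr hlam hσ hτ hτ1 hM.le hσM hε hη hδ h1 h2 hf0 hf1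
        hf.expect_le fun S hS b => ?_
      have hMS : M ≤ M ^ #S := le_self_pow₀ hM.le hS.card_pos.ne'
      have hg := hf.restr hM.le hη0.le S b
      have h3 := ih (M ^ #S * η) (ProductCube.restr S b f) (by
          rw [pow_succ, mul_assoc] at hu
          exact hu.trans (by gcongr))
        (hη.trans (le_mul_of_one_le_left hη0.le (one_le_pow₀ hM.le)))
        (fun x => hf0 _) (fun x => hf1 _) hg
      have h4 : σ ^ 2 ≤ lam := by
        have : 2 * σ ^ 2 = τ * lam := by rw [hσ, hτ]; ring
        nlinarith [sq_nonneg σ]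
      have h5 := stab_mono (sq_nonneg σ) h4 (ProductCube.restr S b f)
      have h6 : (𝔼 x, ProductCube.restr S b f x) ^ 2 ≤ (M ^ #S * η) ^ 2 :=
        pow_le_pow_left₀ (expect_nonneg fun x _ => hf0 _) hg.expect_le 2
      have h7 : δ * (M ^ #S * η) ^ 2 ≤ (M ^ #S * η) ^ 2 :=
        mul_le_of_le_one_left (by positivity) hδ1
      linarith
  obtain ⟨u, hu⟩ := pow_unbounded_of_one_lt η⁻¹ hM
  have hη0 : 0 < η := hε.trans_le hη
  refine key u η f ?_ hη hf0 hf1 hf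
  rw [inv_lt_iff_one_lt_mul₀ hη0] at hu
  exact hu.le

/-! ### Random subcubes and pairwise disagreement. -/

lemma expect_perm_comp (τ : Equiv.Perm α) (F : Equiv.Perm α → ℝ) :
    𝔼 σ, F (σ * τ) = 𝔼 σ, F σ :=
  Fintype.expect_equiv (Equiv.mulRight τ) _ _ fun _ => rfl

lemma expect_perm_mem (Q : Finset α) (c : α) :
    𝔼 σ : Equiv.Perm α, (if σ c ∈ Q then (1 : ℝ) else 0) = #Q / Fintype.card α := by
  have h : ∀ d, 𝔼 σ : Equiv.Perm α, (if σ d ∈ Q then (1 : ℝ) else 0)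
      = 𝔼 σ : Equiv.Perm α, (if σ c ∈ Q then (1 : ℝ) else 0) := by
    intro d
    rw [← expect_perm_comp (Equiv.swap c d)]
    simp
  have h2 : 𝔼 d, 𝔼 σ : Equiv.Perm α, (if σ d ∈ Q then (1 : ℝ) else 0)
      = #Q / Fintype.card α := by
    rw [expect_comm]
    have : ∀ σ : Equiv.Perm α, 𝔼 d, (if σ d ∈ Q then (1 : ℝ) else 0) = #Q / Fintype.card α := by
      intro σ
      rw [Fintype.expect_equiv σ _ (fun d => if d ∈ Q then (1 : ℝ) else 0) (fun _ => rfl),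
        Fintype.expect_eq_sum_div_card]
      simp
    simp_rw [this]
    simp
  simp_rw [h] at h2
  simpa using h2

/-- By symmetry the value is the same for all second points other than `c`, and the sum over all
second points is known since a permutation hits `Q` exactly `#Q` times. -/
lemma expect_perm_mem_mem (Q : Finset α) {c c' : α} (hc : c ≠ c') :
    𝔼 σ : Equiv.Perm α, ((if σ c ∈ Q then (1 : ℝ) else 0) * (if σ c' ∈ Q then 1 else 0))
      = #Q * (#Q - 1) / (Fintype.card α * (Fintype.card α - 1)) := by
  set Z : α → ℝ := fun d =>
    𝔼 σ : Equiv.Perm α, ((if σ c ∈ Q then (1 : ℝ) else 0) * (if σ d ∈ Q then 1 else 0)) with hZ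
  have h : ∀ d, d ≠ c → Z d = Z c' := by
    intro d hd
    simp only [hZ]
    rw [← expect_perm_comp (Equiv.swap c' d)]
    simp [Equiv.swap_apply_of_ne_of_ne hc hd.symm]
  have hZc : Z c = #Q / Fintype.card α := by
    simp only [hZ]
    rw [← expect_perm_mem Q c]
    exact expect_congr rfl fun σ _ => by split_ifs <;> simp
  have hsum : ∑ d, Z d = #Q * #Q / Fintype.card α := by
    simp only [hZ]
    rw [← expect_sum_comm]
    simp_rw [← Finset.mul_sum]
    have : ∀ σ : Equiv.Perm α, ∑ d, (if σ d ∈ Q then (1 : ℝ) else 0) = #Q := by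
      intro σ
      rw [Fintype.sum_equiv σ _ (fun d => if d ∈ Q then (1 : ℝ) else 0) (fun _ => rfl)]
      simp
    simp_rw [this, ← expect_mul, expect_perm_mem]
    ring
  have hcard : (1 : ℝ) < Fintype.card α := by
    exact_mod_cast Fintype.one_lt_card_iff.2 ⟨c, c', hc⟩
  rw [← Finset.add_sum_erase _ _ (mem_univ c), hZc,
    sum_congr rfl (fun d hd => h d (ne_of_mem_erase hd)), sum_const, card_erase_of_mem (mem_univ c),
    card_univ, nsmul_eq_mul, Nat.cast_sub Fintype.card_pos] at hsum
  change Z c' = _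
  have h1 : (Fintype.card α : ℝ) - 1 ≠ 0 := by linarith
  have h0 : (Fintype.card α : ℝ) ≠ 0 := by linarith
  push_cast at hsum
  field_simp at hsum ⊢
  linarith

/-- The correlation of two points of the cube with alphabet `α` lying in the same random subcube
whose sides have size `t`. -/
noncomputable def subcubeCorr (α : Type*) [Fintype α] (t : ℕ) : ℝ :=
  ((Fintype.card α : ℝ) - t) / ((Fintype.card α - 1) * t)

/-- This identifies the joint law of two points of one random subcube with the noise kernel, so the
second moment of `subcubeMean` is a noise stability. -/
lemma expect_perm_kernel (Q : Finset α) (hQ : 0 < #Q) (hα : 1 < Fintype.card α) (c c' : α) :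
    𝔼 σ : Equiv.Perm α, ((Fintype.card α / #Q * (if σ c ∈ Q then (1 : ℝ) else 0)) *
      (Fintype.card α / #Q * (if σ c' ∈ Q then 1 else 0)))
      = 1 + subcubeCorr α #Q * meanZeroKernel c c' := by
  have hα' : (1 : ℝ) < Fintype.card α := by exact_mod_cast hα
  have h1 : (Fintype.card α : ℝ) - 1 ≠ 0 := by linarith
  have h0 : (Fintype.card α : ℝ) ≠ 0 := by linarith
  have hQ' : (#Q : ℝ) ≠ 0 := by exact_mod_cast hQ.ne'
  simp_rw [mul_mul_mul_comm, ← mul_expect]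
  by_cases h : c = c'
  · subst h
    have e : ∀ σ : Equiv.Perm α, (if σ c ∈ Q then (1 : ℝ) else 0) * (if σ c ∈ Q then 1 else 0)
        = if σ c ∈ Q then (1 : ℝ) else 0 := by intro σ; split_ifs <;> simp
    simp_rw [e, expect_perm_mem]
    rw [meanZeroKernel, if_pos rfl, subcubeCorr]
    field_simp
    ring
  · rw [expect_perm_mem_mem Q h, meanZeroKernel, if_neg h, subcubeCorr]
    field_simp
    ring

/-- The density of `w` on the subcube with sides the preimages of `Q` under the `π i`. -/
noncomputable def subcubeMean (Q : Finset α) (w : (ι → α) → ℝ) (π : ι → Equiv.Perm α) : ℝ :=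
  𝔼 x, w x * ∏ i, ((Fintype.card α : ℝ) / #Q * (if π i (x i) ∈ Q then 1 else 0))

lemma expect_subcubeMean (Q : Finset α) (hQ : 0 < #Q) (w : (ι → α) → ℝ) :
    𝔼 π, subcubeMean Q w π = 𝔼 x, w x := by
  simp_rw [subcubeMean]
  rw [expect_comm]
  refine expect_congr rfl fun x _ => ?_
  rw [← mul_expect, expect_prod (fun (i : ι) (σ : Equiv.Perm α) =>
    (Fintype.card α : ℝ) / #Q * (if σ (x i) ∈ Q then 1 else 0))]
  have hQ' : (#Q : ℝ) ≠ 0 := by exact_mod_cast hQ.ne'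
  have h0 := (card_pos_real (α := α)).ne'
  simp_rw [← mul_expect, expect_perm_mem]
  rw [prod_eq_one fun i _ => by field_simp, mul_one]

lemma expect_subcubeMean_sq (Q : Finset α) (hQ : 0 < #Q) (hα : 1 < Fintype.card α)
    (w : (ι → α) → ℝ) :
    𝔼 π, subcubeMean Q w π ^ 2 = stab (subcubeCorr α #Q) w := by
  simp_rw [subcubeMean, pow_two, expect_mul_expect, stab, op, mul_expect]
  rw [expect_comm]
  refine expect_congr rfl fun x _ => ?_
  rw [expect_comm]
  refine expect_congr rfl fun y _ => ?_
  simp_rw [mul_mul_mul_comm (w x), ← Finset.prod_mul_distrib, ← mul_expect]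
  rw [expect_prod (fun (i : ι) (σ : Equiv.Perm α) =>
    ((Fintype.card α : ℝ) / #Q * (if σ (x i) ∈ Q then 1 else 0)) *
      (Fintype.card α / #Q * (if σ (y i) ∈ Q then 1 else 0)))]
  simp_rw [expect_perm_kernel Q hQ hα]
  ring

lemma expect_subcubeMean_sub_sq (Q : Finset α) (hQ : 0 < #Q) (hα : 1 < Fintype.card α)
    (w : (ι → α) → ℝ) :
    𝔼 π, (subcubeMean Q w π - 𝔼 x, w x) ^ 2
      = stab (subcubeCorr α #Q) w - (𝔼 x, w x) ^ 2 := by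
  simp_rw [sub_sq, expect_add_distrib, expect_sub_distrib, expect_subcubeMean_sq Q hQ hα,
    ← expect_mul, ← mul_expect, expect_subcubeMean Q hQ]
  simp; ring

/-- Functions with noise stability close to the square of their mean have supports containing
points that pairwise differ in all coordinates. -/
theorem exists_pairwise_disagreeing {β : Type*} [Fintype β] {t : ℕ} (ht : 0 < t)
    (hα : 1 < Fintype.card α) (Q : β → Finset α) (hQ : ∀ j, #(Q j) = t)
    (hdisj : ∀ j j', j ≠ j' → Disjoint (Q j) (Q j')) {δ : ℝ}
    (hδ : Fintype.card β * δ < 1) (w : β → (ι → α) → ℝ) (hw : ∀ j, 0 < 𝔼 x, w j x)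
    (hstab : ∀ j, stab (subcubeCorr α t) (w j) - (𝔼 x, w j x) ^ 2 ≤ δ * (𝔼 x, w j x) ^ 2) :
    ∃ x : β → ι → α, (∀ j, w j (x j) ≠ 0) ∧ ∀ j j', j ≠ j' → ∀ i, x j i ≠ x j' i := by
  have h1 : 𝔼 π, ∑ j, (subcubeMean (Q j) (w j) π - 𝔼 x, w j x) ^ 2 / (𝔼 x, w j x) ^ 2 < 1 := by
    rw [expect_sum_comm]
    refine lt_of_le_of_lt (sum_le_sum fun j _ => ?_) (b := ∑ _j : β, δ) (by simpa using hδ)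
    rw [← expect_div, expect_subcubeMean_sub_sq (Q j) (by rw [hQ j]; exact ht) hα,
      div_le_iff₀ (by have := hw j; positivity), hQ j]
    exact hstab j
  obtain ⟨π, -, hπ⟩ := exists_lt_of_expect_lt univ_nonempty h1
  have h2 : ∀ j, ∃ x, w j x ≠ 0 ∧ ∀ i, π i (x i) ∈ Q j := by
    intro j
    -- A vanishing density would contribute exactly 1 to a sum of nonnegative terms that is below 1.
    have h3 : subcubeMean (Q j) (w j) π ≠ 0 := by
      intro h0
      have h4 := single_le_sum (f := fun j => (subcubeMean (Q j) (w j) π - 𝔼 x, w j x) ^ 2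
        / (𝔼 x, w j x) ^ 2) (fun j _ => by positivity) (mem_univ j)
      simp only [h0, zero_sub, neg_sq] at h4
      rw [div_self (by have := hw j; positivity)] at h4
      linarith
    obtain ⟨x, -, hx⟩ := exists_ne_zero_of_expect_ne_zero h3
    refine ⟨x, left_ne_zero_of_mul hx, fun i => ?_⟩
    by_contra hi
    exact right_ne_zero_of_mul hx (prod_eq_zero (mem_univ i) (by simp [hi]))
  choose x hx hxQ using h2
  refine ⟨x, hx, fun j j' hjj i hi => ?_⟩
  exact Finset.disjoint_left.1 (hdisj j j' hjj) (hxQ j i) (hi ▸ hxQ j' i)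

/-! ### Popular letters and the prescribed agreements. -/

lemma restr_congr {S : Finset ι} {b c : ι → α} (h : ∀ i ∈ S, b i = c i) (f : (ι → α) → ℝ) :
    restr S b f = restr S c f := by
  ext y
  simp only [restr]
  congr 1
  ext i
  by_cases hi : i ∈ S
  · simp [hi, h i hi]
  · simp [hi]

lemma restr_singleton (i : ι) (b : ι → α) (f : (ι → α) → ℝ) (x : ι → α) :
    restr {i} b f x = f (update x i (b i)) := by
  simp [restr, Finset.piecewise_singleton]

lemma expect_mul_coord (i : ι) (φ : α → ℝ) (w : (ι → α) → ℝ) :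
    𝔼 x, w x * φ (x i) = 𝔼 c, φ c * 𝔼 x, restr {i} (fun _ => c) w x := by
  rw [← expect_update i]
  simp_rw [update_self, mul_expect]
  rw [expect_comm]
  refine expect_congr rfl fun c _ => expect_congr rfl fun x _ => ?_
  rw [restr_singleton, mul_comm]

/-- The values `c` at the coordinate `i` whose restriction loses more than half of the mean. -/
noncomputable def unpopular (w : (ι → α) → ℝ) (i : ι) : Finset α :=
  {c | 𝔼 x, restr {i} (fun _ => c) w x < (𝔼 x, w x) / 2}

/-- Let `N x` count the coordinates of `x` with unpopular letters, and let `p i` be the proportion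
of unpopular letters at `i`. Weighted by `w`, the mean of `N` is at most `(∑ p) / 2`, so Jensen
bounds `𝔼 w * exp (-N)` from below; independence bounds it from above by `exp (-(5 / 8) * ∑ p)`. The
gap `5 / 8 - 1 / 2 = 1 / 8` gives the constant 8. -/
lemma sum_card_unpopular_le (w : (ι → α) → ℝ) (h0 : ∀ x, 0 ≤ w x) (h1 : ∀ x, w x ≤ 1)
    (hμ : 0 < 𝔼 x, w x) :
    ∑ i, (#(unpopular w i) : ℝ) / Fintype.card α ≤ 8 * Real.log (1 / 𝔼 x, w x) := by
  set μ := 𝔼 x, w x with hμdef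
  set p : ι → ℝ := fun i => (#(unpopular w i) : ℝ) / Fintype.card α with hp
  set N : (ι → α) → ℝ := fun x => ∑ i, if x i ∈ unpopular w i then 1 else 0 with hN
  have hind : ∀ i, 𝔼 c, (if c ∈ unpopular w i then (1 : ℝ) else 0) = p i := by
    intro i; rw [Fintype.expect_eq_sum_div_card]; simp [hp]
  have hwN : 𝔼 x, w x * N x ≤ (∑ i, p i) * (μ / 2) := by
    simp_rw [hN, Finset.mul_sum]
    rw [expect_sum_comm, Finset.sum_mul]
    refine sum_le_sum fun i _ => ?_
    rw [expect_mul_coord i (fun c => if c ∈ unpopular w i then 1 else 0), ← hind i, expect_mul]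
    refine expect_le_expect fun c _ => ?_
    by_cases hc : c ∈ unpopular w i
    · simp only [hc, if_true, one_mul]
      exact (mem_filter.1 hc).2.le
    · simp [hc]
  set a := (𝔼 x, w x * N x) / μ with ha
  have haμ : a * μ = 𝔼 x, w x * N x := by rw [ha]; field_simp
  have hlow : μ * Real.exp (-a) ≤ 𝔼 x, w x * Real.exp (-N x) := by
    calc μ * Real.exp (-a) = 𝔼 x, Real.exp (-a) * (w x * (1 + a) - w x * N x) := by
          rw [← mul_expect, expect_sub_distrib, ← expect_mul, ← haμ]; ring
      -- Jensen through the tangent line of `exp` at the weighted mean `-a` of `-N`.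
      _ ≤ _ := by
          refine expect_le_expect fun x _ => ?_
          have e : Real.exp (-N x) = Real.exp (-a) * Real.exp (a - N x) := by
            rw [← Real.exp_add]; ring_nf
          rw [e]
          have h2 := Real.add_one_le_exp (a - N x)
          have h3 := Real.exp_pos (-a)
          have h4 : w x * (a - N x + 1) ≤ w x * Real.exp (a - N x) :=
            mul_le_mul_of_nonneg_left h2 (h0 x)
          nlinarith
  have he : (5 / 8 : ℝ) ≤ 1 - Real.exp (-1) := by
    have := Real.exp_neg_one_lt_d9
    linarith
  have hup : 𝔼 x, w x * Real.exp (-N x) ≤ Real.exp (-(5 / 8 * ∑ i, p i)) := by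
    calc 𝔼 x, w x * Real.exp (-N x) ≤ 𝔼 x, Real.exp (-N x) :=
          expect_le_expect fun x _ => mul_le_of_le_one_left (Real.exp_pos _).le (h1 x)
      _ = 𝔼 x : ι → α, ∏ i, Real.exp (-(if x i ∈ unpopular w i then 1 else 0)) := by
          refine expect_congr rfl fun x _ => ?_
          rw [← Real.exp_sum, hN, Finset.sum_neg_distrib]
      _ = ∏ i, 𝔼 c, Real.exp (-(if c ∈ unpopular w i then 1 else 0)) :=
          expect_prod (fun i c => Real.exp (-(if c ∈ unpopular w i then 1 else 0)))
      _ ≤ ∏ i, Real.exp (-(5 / 8 * p i)) := by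
          refine prod_le_prod (fun i _ => expect_nonneg fun c _ => (Real.exp_pos _).le) fun i _ => ?_
          have e : ∀ c, Real.exp (-(if c ∈ unpopular w i then 1 else 0))
              = 1 - (1 - Real.exp (-1)) * (if c ∈ unpopular w i then 1 else 0) := by
            intro c; split_ifs <;> simp
          simp_rw [e, expect_sub_distrib, ← mul_expect, hind]
          have hp0 : 0 ≤ p i := by simp only [hp]; positivity
          have := Real.add_one_le_exp (-(5 / 8 * p i))
          simp only [expect_const univ_nonempty]
          nlinarith
      _ = _ := by rw [← Real.exp_sum, Finset.sum_neg_distrib, Finset.mul_sum]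
  have hfin : μ * Real.exp (-a) ≤ Real.exp (-(5 / 8 * ∑ i, p i)) := hlow.trans hup
  have ha2 : a ≤ (∑ i, p i) / 2 := by
    rw [ha, div_le_iff₀ hμ]; linarith
  have hlog := Real.log_le_log (by positivity) hfin
  rw [Real.log_exp, Real.log_mul hμ.ne' (Real.exp_pos _).ne', Real.log_exp] at hlog
  rw [one_div, Real.log_inv]
  linarith

/-- A coordinate outside a given set at which many values are popular for all functions. -/
lemma exists_popular_coord {β : Type*} [Fintype β] (w : β → (ι → α) → ℝ)
    (h0 : ∀ j x, 0 ≤ w j x) (h1 : ∀ j x, w j x ≤ 1) {ε : ℝ} (hε : 0 < ε)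
    (hw : ∀ j, ε ≤ 𝔼 x, w j x) (Z : Finset ι) {D : ℕ} (hD : 2 * D ≤ Fintype.card α)
    (hZ : #Z + 16 * Fintype.card β * Real.log (1 / ε) < Fintype.card ι) :
    ∃ i ∉ Z, ∃ G : Finset α, D ≤ #G ∧
      ∀ j, ∀ c ∈ G, (𝔼 x, w j x) / 2 ≤ 𝔼 x, restr {i} (fun _ => c) (w j) x := by
  by_contra! hcon
  have hm := card_pos_real (α := α)
  have hbad : ∀ i ∈ Zᶜ, (1 / 2 : ℝ) ≤ ∑ j, (#(unpopular (w j) i) : ℝ) / Fintype.card α := by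
    intro i hi
    by_contra! hlt
    rw [← Finset.sum_div, div_lt_iff₀ hm] at hlt
    set U : Finset α := univ.biUnion fun j => unpopular (w j) i with hU
    have hUcard : (#U : ℝ) ≤ ∑ j, (#(unpopular (w j) i) : ℝ) := by
      exact_mod_cast card_biUnion_le
    have hUc : #U + #Uᶜ = Fintype.card α := card_add_card_compl U
    have hG : D ≤ #Uᶜ := by
      have h2 : (2 * D : ℝ) ≤ Fintype.card α := by exact_mod_cast hD
      have h3 : (#U : ℝ) + #Uᶜ = Fintype.card α := by exact_mod_cast hUc
      have : (D : ℝ) ≤ #Uᶜ := by linarith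
      exact_mod_cast this
    obtain ⟨j, c, hc, hlt⟩ := hcon i (mem_compl.1 hi) Uᶜ hG
    refine mem_compl.1 hc (mem_biUnion.2 ⟨j, mem_univ j, ?_⟩)
    exact mem_filter.2 ⟨mem_univ c, hlt⟩
  have hsum : (#Zᶜ : ℝ) / 2 ≤ Fintype.card β * (8 * Real.log (1 / ε)) := by
    calc (#Zᶜ : ℝ) / 2 = ∑ i ∈ Zᶜ, (1 / 2 : ℝ) := by simp; ring
      _ ≤ ∑ i ∈ Zᶜ, ∑ j, (#(unpopular (w j) i) : ℝ) / Fintype.card α := sum_le_sum hbad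
      _ ≤ ∑ i, ∑ j, (#(unpopular (w j) i) : ℝ) / Fintype.card α :=
          sum_le_sum_of_subset_of_nonneg (subset_univ _)
            fun i _ _ => sum_nonneg fun j _ => by positivity
      _ = ∑ j, ∑ i, (#(unpopular (w j) i) : ℝ) / Fintype.card α := sum_comm
      _ ≤ ∑ _j : β, 8 * Real.log (1 / ε) := by
          refine sum_le_sum fun j _ => ?_
          refine (sum_card_unpopular_le (w j) (h0 j) (h1 j) (hε.trans_le (hw j))).trans ?_
          have := hε.trans_le (hw j)
          gcongr
          exact hw j
      _ = _ := by simp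
  have hc : (#Z : ℝ) + #Zᶜ = Fintype.card ι := by exact_mod_cast card_add_card_compl Z
  linarith

/-- Popular coordinates, one for each part in `P`, with values following a given pattern. -/
lemma exists_popular_restriction {β κ V : Type*} [Fintype β] [Fintype κ] [DecidableEq κ]
    [Fintype V] (v : β → κ → V) (w : β → (ι → α) → ℝ)
    (h0 : ∀ j x, 0 ≤ w j x) (h1 : ∀ j x, w j x ≤ 1) {ε : ℝ} (hε : 0 < ε)
    (hw : ∀ j, ε ≤ 𝔼 x, w j x) (Z : Finset ι) (hV : 2 * Fintype.card V ≤ Fintype.card α)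
    (hZ : #Z + Fintype.card κ + 16 * Fintype.card β * Real.log (1 / (ε / 2 ^ Fintype.card κ))
      < Fintype.card ι) (P : Finset κ) :
    ∃ (Φ : κ → ι) (c : β → ι → α), Set.InjOn Φ P ∧ (∀ p ∈ P, Φ p ∉ Z) ∧
      (∀ p ∈ P, ∀ j j', c j (Φ p) = c j' (Φ p) ↔ v j p = v j' p) ∧
      ∀ j, (𝔼 x, w j x) / 2 ^ #P ≤ 𝔼 x, restr (P.image Φ) (c j) (w j) x := by
  induction P using Finset.induction_on with
  | empty =>
    -- A coordinate is needed as the default value of `Φ`; `hZ` rules out an empty index set.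
    have hι : Nonempty ι := by
      rw [← Fintype.card_pos_iff]
      by_contra! hcon
      have hι0 : Fintype.card ι = 0 := by omega
      have hα : (∀ j, ε ≤ 1) := fun j : β => (hw j).trans
        (expect_le univ_nonempty fun x _ => h1 j x)
      rw [hι0] at hZ
      rcases isEmpty_or_nonempty β with hβ | ⟨⟨j⟩⟩
      · simp at hZ
        have : (0 : ℝ) ≤ #Z + Fintype.card κ := by positivity
        linarith
      · have hlog : 0 ≤ Real.log (1 / (ε / 2 ^ Fintype.card κ)) := by
          refine Real.log_nonneg ?_
          rw [le_div_iff₀ (by positivity), one_mul]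
          refine (div_le_one (by positivity)).2 ((hα j).trans (one_le_pow₀ (by norm_num)))
        have : (0 : ℝ) ≤ #Z + Fintype.card κ
          + 16 * Fintype.card β * Real.log (1 / (ε / 2 ^ Fintype.card κ)) := by positivity
        push_cast at hZ
        linarith
    refine ⟨fun _ => Classical.arbitrary ι, fun _ _ => Classical.arbitrary α, by simp, by simp,
      by simp, fun j => ?_⟩
    simp [restr_empty]
  | insert p P hp ih =>
    obtain ⟨Φ, c, hΦ, hΦZ, hpat, hmean⟩ := ih
    have hPκ : #P ≤ Fintype.card κ := card_le_univ P
    obtain ⟨i, hiZ, G, hG, hpop⟩ := exists_popular_coord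
      (fun j => restr (P.image Φ) (c j) (w j)) (fun j x => h0 j _) (fun j x => h1 j _)
      (ε := ε / 2 ^ Fintype.card κ) (by positivity)
      (fun j => by
        refine le_trans ?_ (hmean j)
        exact div_le_div₀ (hε.le.trans (hw j)) (hw j) (by positivity)
          (pow_le_pow_right₀ (by norm_num) hPκ))
      (Z ∪ P.image Φ) hV (by
        have h2 : #(Z ∪ P.image Φ) ≤ #Z + Fintype.card κ :=
          (card_union_le _ _).trans (by gcongr; exact card_image_le.trans hPκ)
        have h3 : (#(Z ∪ P.image Φ) : ℝ) ≤ #Z + Fintype.card κ := by exact_mod_cast h2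
        linarith)
    rw [mem_union, not_or] at hiZ
    -- An injection of the vertices into the popular letters makes equality of letters equivalent to
    -- equality of vertices.
    obtain ⟨e⟩ := Function.Embedding.nonempty_of_card_le (α := V) (β := G) (by simpa using hG)
    have hΦp : ∀ q ∈ P, update Φ p i q = Φ q := by
      rintro q hq
      have : q ≠ p := by rintro rfl; exact hp hq
      rw [update_of_ne this]
    have hΦi : ∀ q ∈ P, Φ q ≠ i := fun q hq h => hiZ.2 (h ▸ mem_image_of_mem Φ hq)
    have himg : (insert p P).image (update Φ p i) = insert i (P.image Φ) := by
      rw [image_insert, update_self]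
      congr 1
      exact image_congr fun q hq => hΦp q hq
    refine ⟨update Φ p i, fun j => update (c j) i (e (v j p)), ?_, ?_, ?_, ?_⟩
    · rw [coe_insert, Set.injOn_insert (by simpa using hp)]
      refine ⟨fun q hq q' hq' h => ?_, ?_⟩
      · rw [hΦp q hq, hΦp q' hq'] at h
        exact hΦ hq hq' h
      · rintro ⟨q, hq, h⟩
        rw [hΦp q hq, update_self] at h
        exact hΦi q hq h
    · intro q hq
      rcases mem_insert.1 hq with rfl | hq
      · rw [update_self]; exact hiZ.1
      · rw [hΦp q hq]; exact hΦZ q hq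
    · intro q hq j j'
      rcases mem_insert.1 hq with rfl | hq
      · simp only [update_self]
        rw [← Subtype.ext_iff, e.injective.eq_iff]
      · simp only [hΦp q hq, update_of_ne (hΦi q hq)]
        exact hpat q hq j j'
    · intro j
      have h2 := hpop j (e (v j p)) (e (v j p)).2
      rw [restr_restr] at h2
      rw [himg, card_insert_of_notMem hp, pow_succ, ← div_div]
      have h3 : restr (insert i (P.image Φ)) (update (c j) i (e (v j p))) (w j)
          = restr (P.image Φ ∪ {i}) ((P.image Φ).piecewise (c j) fun _ => e (v j p)) (w j) := by
        rw [union_comm, ← insert_eq]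
        refine restr_congr (fun i' hi' => ?_) _
        rcases mem_insert.1 hi' with rfl | hi'
        · simp only [update_self, piecewise_eq_of_notMem _ _ _ hiZ.2]
        · have : i' ≠ i := fun h => hiZ.2 (h ▸ hi')
          rw [update_of_ne this, piecewise_eq_of_mem _ _ _ hi']
      rw [h3]
      exact (div_le_div_of_nonneg_right (hmean j) (by norm_num)).trans h2

/-! ### Compatible global restrictions. -/

/-- Some restriction of `f` to few coordinates is global. -/
lemma exists_global_restriction (f : (ι → α) → ℝ) (h1 : ∀ x, f x ≤ 1) {M : ℝ} (hM : 1 ≤ M)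
    (hμ : 0 < 𝔼 x, f x) :
    ∃ (S : Finset ι) (a : ι → α), M ^ #S * 𝔼 x, f x ≤ 1 ∧ 𝔼 x, f x ≤ 𝔼 x, restr S a f x ∧
      IsGlobal M (𝔼 x, restr S a f x) (restr S a f) := by
  have hM0 : 0 < M := by linarith
  -- Density increment in one step: maximise the mean against the price `M ^ #S`. Maximality is
  -- globalness, and comparison with the empty restriction bounds `#S`.
  obtain ⟨⟨S, a⟩, hmax⟩ := Finite.exists_max
    (fun p : Finset ι × (ι → α) => (𝔼 x, restr p.1 p.2 f x) / M ^ #p.1)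
  have hmax' : ∀ T b, 𝔼 x, restr T b f x ≤ M ^ #T * ((𝔼 x, restr S a f x) / M ^ #S) := by
    intro T b
    have := hmax (T, b)
    rw [div_le_iff₀ (by positivity)] at this
    linarith
  have h2 : M ^ #S * 𝔼 x, f x ≤ 𝔼 x, restr S a f x := by
    have := hmax' ∅ a
    rw [restr_empty, card_empty, pow_zero, one_mul, le_div_iff₀ (by positivity)] at this
    linarith
  have h3 : 1 ≤ M ^ #S := one_le_pow₀ hM
  have h4 : 𝔼 x, f x ≤ 𝔼 x, restr S a f x := le_trans (by nlinarith) h2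
  refine ⟨S, a, h2.trans (expect_le univ_nonempty fun x _ => h1 _), h4, fun T b => ?_⟩
  rw [restr_restr]
  refine (hmax' _ _).trans ?_
  have h5 : M ^ #(S ∪ T) ≤ M ^ #S * M ^ #T := by
    rw [← pow_add]
    exact pow_le_pow_right₀ hM (card_union_le _ _)
  have h6 : 0 ≤ (𝔼 x, restr S a f x) / M ^ #S := div_nonneg (hμ.le.trans h4) (by positivity)
  calc _ ≤ (M ^ #S * M ^ #T) * ((𝔼 x, restr S a f x) / M ^ #S) := by gcongr
    _ = _ := by field_simp

/-- Removing the points lying in one of the dictators in `D`. -/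
def avoid (D : Finset (ι × α)) (f : (ι → α) → ℝ) (x : ι → α) : ℝ :=
  if ∀ d ∈ D, x d.1 ≠ d.2 then f x else 0

lemma avoid_nonneg {D : Finset (ι × α)} {f : (ι → α) → ℝ} (h0 : ∀ x, 0 ≤ f x) (x : ι → α) :
    0 ≤ avoid D f x := by
  unfold avoid; split_ifs
  · exact h0 x
  · exact le_rfl

lemma avoid_le {D : Finset (ι × α)} {f : (ι → α) → ℝ} (h0 : ∀ x, 0 ≤ f x) (x : ι → α) :
    avoid D f x ≤ f x := by
  unfold avoid; split_ifs
  · exact le_rfl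
  · exact h0 x

lemma of_avoid_ne_zero {D : Finset (ι × α)} {f : (ι → α) → ℝ} {x : ι → α} (h : avoid D f x ≠ 0) :
    f x ≠ 0 ∧ ∀ d ∈ D, x d.1 ≠ d.2 := by
  unfold avoid at h
  split_ifs at h with h2
  · exact ⟨h, h2⟩
  · exact absurd rfl h

/-- Removing few dictators from a global function loses little. -/
lemma IsGlobal.le_expect_avoid {M : ℝ} {f : (ι → α) → ℝ} (h0 : ∀ x, 0 ≤ f x)
    (hf : IsGlobal M (𝔼 x, f x) f) (D : Finset (ι × α)) (hD : #D * M / Fintype.card α ≤ 1 / 2) :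
    (𝔼 x, f x) / 2 ≤ 𝔼 x, avoid D f x := by
  have hμ : 0 ≤ 𝔼 x, f x := expect_nonneg fun x _ => h0 x
  have h1 : ∀ d : ι × α, 𝔼 x, f x * (if x d.1 = d.2 then 1 else 0)
      ≤ M * (𝔼 x, f x) / Fintype.card α := by
    intro d
    rw [expect_mul_coord d.1 (fun c => if c = d.2 then 1 else 0)]
    rw [Fintype.expect_eq_sum_div_card]
    simp only [ite_mul, one_mul, zero_mul, sum_ite_eq', mem_univ, if_true]
    gcongr
    simpa using hf {d.1} (fun _ => d.2)
  have h2 : 𝔼 x, f x ≤ 𝔼 x, avoid D f x + ∑ d ∈ D, 𝔼 x, f x * (if x d.1 = d.2 then 1 else 0) := by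
    rw [← expect_sum_comm, ← expect_add_distrib]
    refine expect_le_expect fun x _ => ?_
    have hs : ∀ d ∈ D, 0 ≤ f x * (if x d.1 = d.2 then 1 else 0) := fun d _ =>
      mul_nonneg (h0 x) (by split_ifs <;> norm_num)
    unfold avoid
    split_ifs with h
    · have := sum_nonneg hs
      linarith
    · push Not at h
      obtain ⟨d, hd, hxd⟩ := h
      have := single_le_sum hs hd
      simp only [hxd, if_true, mul_one] at this
      linarith
  have h3 : ∑ d ∈ D, 𝔼 x, f x * (if x d.1 = d.2 then 1 else 0) ≤ (𝔼 x, f x) / 2 := by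
    calc _ ≤ ∑ _d ∈ D, M * (𝔼 x, f x) / Fintype.card α := sum_le_sum fun d _ => h1 d
      _ = (#D * M / Fintype.card α) * 𝔼 x, f x := by rw [sum_const, nsmul_eq_mul]; ring
      _ ≤ 1 / 2 * 𝔼 x, f x := by gcongr
      _ = _ := by ring
  linarith

/-- Compatible global restrictions of finitely many functions that are robust under the removal of
few dictators: fixed coordinates outside `T` never receive equal values. -/
lemma exists_global_restrictions {β : Type*} [Fintype β] [DecidableEq β] (f : β → (ι → α) → ℝ)
    (h0 : ∀ j x, 0 ≤ f j x) (h1 : ∀ j x, f j x ≤ 1) {M ε : ℝ} (hM : 1 < M) (hε : 0 < ε) {K : ℕ}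
    (hK : M ^ K * ε = 1) (R : β → Finset ι)
    (hf : ∀ j, ∀ D : Finset (ι × α), #D ≤ Fintype.card β * K → (∀ d ∈ D, d.1 ∉ R j) →
      ε ≤ 𝔼 x, avoid D (f j) x) (J : Finset β) :
    ∃ (S : β → Finset ι) (a : β → ι → α) (u : β → (ι → α) → ℝ),
      (∀ j ∈ J, #(S j) ≤ K ∧ (∀ x, 0 ≤ u j x) ∧ (∀ x, u j x ≤ 1) ∧ ε ≤ 𝔼 x, u j x ∧
        IsGlobal M (𝔼 x, u j x) (u j) ∧ ∀ x, u j x ≠ 0 → f j ((S j).piecewise (a j) x) ≠ 0) ∧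
      ∀ j ∈ J, ∀ j' ∈ J, j ≠ j' → ∀ i ∈ S j, i ∈ S j' → i ∉ univ.biUnion R → a j i ≠ a j' i := by
  induction J using Finset.induction_on with
  | empty =>
    exact ⟨fun _ => ∅, fun _ _ => Classical.arbitrary α, fun _ _ => 0, by simp, by simp⟩
  | insert j₀ J hj₀ ih =>
    obtain ⟨S, a, u, hu, hdiff⟩ := ih
    -- Values fixed for earlier functions are deleted before `f j₀` is restricted. Coordinates in `R
    -- j₀` are left out because the code ignores them.
    set D : Finset (ι × α) := J.biUnion fun j => (S j \ R j₀).image fun i => (i, a j i) with hD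
    have hDcard : #D ≤ Fintype.card β * K := by
      calc #D ≤ ∑ j ∈ J, #((S j \ R j₀).image fun i => (i, a j i)) := card_biUnion_le
        _ ≤ ∑ _j ∈ J, K := sum_le_sum fun j hj =>
            card_image_le.trans ((card_le_card sdiff_subset).trans (hu j hj).1)
        _ = #J * K := by rw [sum_const, smul_eq_mul]
        _ ≤ _ := by gcongr; exact card_le_univ J
    have hDR : ∀ d ∈ D, d.1 ∉ R j₀ := by
      intro d hd
      obtain ⟨j, -, hd⟩ := mem_biUnion.1 hd
      obtain ⟨i, hi, rfl⟩ := mem_image.1 hd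
      exact (mem_sdiff.1 hi).2
    have hmean := hf j₀ D hDcard hDR
    obtain ⟨S₀, a₀, hS₀, hle, hglob⟩ := exists_global_restriction (avoid D (f j₀))
      (fun x => (avoid_le (h0 j₀) x).trans (h1 j₀ x)) hM.le (hε.trans_le hmean)
    have hcard : #S₀ ≤ K := by
      have : M ^ #S₀ * ε ≤ M ^ K * ε := by
        rw [hK]
        exact le_trans (by gcongr) hS₀
      exact (pow_le_pow_iff_right₀ hM).1 (le_of_mul_le_mul_right this hε)
    set u₀ := restr S₀ a₀ (avoid D (f j₀)) with hu₀
    have hpos : 𝔼 x, u₀ x ≠ 0 := ne_of_gt ((hε.trans_le hmean).trans_le hle)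
    have hnew : ∀ j ∈ J, ∀ i ∈ S j, i ∈ S₀ → i ∉ univ.biUnion R → a j i ≠ a₀ i := by
      intro j hj i hi hi₀ hiR h
      -- If `a₀` fixed a deleted value, the restriction `u₀` would vanish identically, against its
      -- positive mean.
      obtain ⟨x, -, hx⟩ := exists_ne_zero_of_expect_ne_zero hpos
      have hmem : (i, a j i) ∈ D := by
        refine mem_biUnion.2 ⟨j, hj, mem_image.2 ⟨i, mem_sdiff.2 ⟨hi, fun hR => hiR ?_⟩, rfl⟩⟩
        exact mem_biUnion.2 ⟨j₀, mem_univ _, hR⟩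
      have := (of_avoid_ne_zero hx).2 _ hmem
      simp [hi₀, h] at this
    have hne : ∀ j ∈ J, j ≠ j₀ := fun j hj h => hj₀ (h ▸ hj)
    refine ⟨update S j₀ S₀, update a j₀ a₀, update u j₀ u₀, ?_, ?_⟩
    · intro j hj
      rcases mem_insert.1 hj with rfl | hj
      · rw [update_self, update_self, update_self]
        refine ⟨hcard, fun x => avoid_nonneg (h0 j) _,
          fun x => (avoid_le (h0 j) _).trans (h1 j _), hmean.trans hle, hglob, fun x hx => ?_⟩
        exact (of_avoid_ne_zero hx).1
      · rw [update_of_ne (hne j hj), update_of_ne (hne j hj), update_of_ne (hne j hj)]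
        exact hu j hj
    · intro j hj j' hj' hjj i hi hi' hiR
      rcases mem_insert.1 hj with hj0 | hjJ <;> rcases mem_insert.1 hj' with hj0' | hjJ'
      · exact absurd (hj0.trans hj0'.symm) hjj
      · subst hj0
        rw [update_self] at hi ⊢
        rw [update_of_ne (hne j' hjJ')] at hi' ⊢
        exact (hnew j' hjJ' i hi' hi hiR).symm
      · subst hj0'
        rw [update_self] at hi' ⊢
        rw [update_of_ne (hne j hjJ)] at hi ⊢
        exact hnew j hjJ i hi hi' hiR
      · rw [update_of_ne (hne j hjJ)] at hi ⊢
        rw [update_of_ne (hne j' hjJ')] at hi' ⊢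
        exact hdiff j hjJ j' hjJ' hjj i hi hi' hiR

/-- A dense restriction of a global function is global. -/
lemma IsGlobal.restr_of_dense {M : ℝ} {ℓ : ℕ} (hM : 1 ≤ M) {u u' : (ι → α) → ℝ}
    (hu : IsGlobal M (𝔼 x, u x) u) (hle : ∀ x, u' x ≤ u x) {I : Finset ι} (hI : #I ≤ ℓ)
    {c : ι → α} (hmean : 𝔼 x, u x ≤ 2 ^ (ℓ + 1) * 𝔼 x, ProductCube.restr I c u' x)
    (hpos : ∀ x, 0 ≤ u x) :
    IsGlobal ((2 * M) ^ (ℓ + 1)) (𝔼 x, ProductCube.restr I c u' x) (ProductCube.restr I c u') := by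
  intro T b
  -- For nonempty `T` the losses from `I` and from the mean fit into the exponent `(ℓ + 1) * #T`;
  -- the empty set has no room for them but holds with equality.
  rcases T.eq_empty_or_nonempty with rfl | hT
  · simp [restr_empty]
  have hT1 : 1 ≤ #T := hT.card_pos
  have hexp : #(I ∪ T) ≤ (ℓ + 1) * #T := by
    calc #(I ∪ T) ≤ ℓ + #T := (card_union_le _ _).trans (by gcongr)
      _ ≤ (ℓ + 1) * #T := by nlinarith
  rw [restr_restr]
  calc 𝔼 x, ProductCube.restr (I ∪ T) (I.piecewise c b) u' x
      ≤ 𝔼 x, ProductCube.restr (I ∪ T) (I.piecewise c b) u x :=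
        expect_le_expect fun x _ => hle _
    _ ≤ M ^ #(I ∪ T) * 𝔼 x, u x := hu _ _
    _ ≤ M ^ ((ℓ + 1) * #T) * (2 ^ ((ℓ + 1) * #T) * 𝔼 x, ProductCube.restr I c u' x) := by
        refine mul_le_mul (pow_le_pow_right₀ hM hexp) (hmean.trans ?_) ?_ (by positivity)
        · have h0 : 0 ≤ 𝔼 x, ProductCube.restr I c u' x := by
            have := (expect_nonneg fun x _ => hpos x : 0 ≤ 𝔼 x, u x).trans hmean
            exact nonneg_of_mul_nonneg_right this (by positivity)
          gcongr
          · norm_num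
          · nlinarith
        · exact expect_nonneg fun x _ => hpos x
    _ = _ := by rw [← pow_mul, mul_pow]; ring

/-! ### Assembling the agreement pattern. -/

/-- Functions on the cube that are robust under the removal of few dictators contain in their
supports points with a prescribed pattern of agreements. -/
theorem exists_agreement_pattern {β κ V : Type*} [Fintype β] [DecidableEq β] [Fintype κ]
    [DecidableEq κ] [Fintype V] (v : β → κ → V) (f : β → (ι → α) → ℝ)
    (h0 : ∀ j x, 0 ≤ f j x) (h1 : ∀ j x, f j x ≤ 1) {M₀ ε : ℝ} (hM₀ : 1 < M₀) (hε : 0 < ε) {K : ℕ}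
    (hK : M₀ ^ K * ε = 1) (R : β → Finset ι)
    (hf : ∀ j, ∀ D : Finset (ι × α), #D ≤ Fintype.card β * K → (∀ d ∈ D, d.1 ∉ R j) →
      ε ≤ 𝔼 x, avoid D (f j) x)
    (hrem : (Fintype.card β * K : ℕ) * M₀ / Fintype.card α ≤ 1 / 2)
    (hV : 2 * Fintype.card V ≤ Fintype.card α)
    (hcard : #(univ.biUnion R) + Fintype.card β * K + Fintype.card κ
      + 16 * Fintype.card β * Real.log (1 / (ε / 2 / 2 ^ Fintype.card κ)) < Fintype.card ι)
    {t : ℕ} (ht : 0 < t) (hα : 1 < Fintype.card α) (htα : Fintype.card β * t ≤ Fintype.card α)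
    (htα' : t ≤ Fintype.card α)
    {n : ℕ} {lam σ τ M δ ε' : ℝ} (hlam : subcubeCorr α t ≤ lam)
    (hM : M = (2 * M₀) ^ (Fintype.card κ + 1)) (hε' : ε' = ε / 2 / 2 ^ Fintype.card κ)
    (hσ : σ = 4 * (n + 1) * lam) (hτ : τ = 32 * (n + 1) ^ 2 * lam) (hτ1 : τ ≤ 1)
    (hσM : 4 * σ ^ 2 * M ^ 2 ≤ 1) (hδ : 0 < δ) (hδ1 : δ ≤ 1) (hδβ : Fintype.card β * δ < 1)
    (hlamδ : lam ≤ δ) (hn1 : τ ^ (n + 1) ≤ δ ^ (n + 1) * ε' / 2)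
    (hn2 : τ * (8 * σ ^ 2 * M ^ 2) ^ n ≤ δ ^ (2 * n + 1) * ε' / 2) :
    ∃ x : β → ι → α, (∀ j, f j (x j) ≠ 0) ∧ ∃ Φ : κ → ι, Injective Φ ∧
      (∀ p, Φ p ∉ univ.biUnion R) ∧
      (∀ p j j', x j (Φ p) = x j' (Φ p) ↔ v j p = v j' p) ∧
      ∀ i, i ∉ univ.biUnion R → i ∉ Set.range Φ → ∀ j j', j ≠ j' → x j i ≠ x j' i := by
  set T := univ.biUnion R with hT
  obtain ⟨S, a, u, hu, hdiff⟩ := exists_global_restrictions f h0 h1 hM₀ hε hK R hf univ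
  have hu0 : ∀ j x, 0 ≤ u j x := fun j => (hu j (mem_univ j)).2.1
  have hu1 : ∀ j x, u j x ≤ 1 := fun j => (hu j (mem_univ j)).2.2.1
  have huε : ∀ j, ε ≤ 𝔼 x, u j x := fun j => (hu j (mem_univ j)).2.2.2.1
  have huglob : ∀ j, IsGlobal M₀ (𝔼 x, u j x) (u j) := fun j => (hu j (mem_univ j)).2.2.2.2.1
  have huf : ∀ j x, u j x ≠ 0 → f j ((S j).piecewise (a j) x) ≠ 0 :=
    fun j => (hu j (mem_univ j)).2.2.2.2.2
  -- These dictators stop a free coordinate of one point from matching a value fixed for another.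
  -- They depend on all the restrictions, so they are removed only now, at the cost of half the mean
  -- by globalness.
  set D : β → Finset (ι × α) := fun j =>
    univ.biUnion fun j' => (S j' \ S j).image fun i => (i, a j' i) with hD
  have hDcard : ∀ j, #(D j) ≤ Fintype.card β * K := by
    intro j
    calc #(D j) ≤ ∑ j', #((S j' \ S j).image fun i => (i, a j' i)) := card_biUnion_le
      _ ≤ ∑ _j' : β, K := sum_le_sum fun j' hj' =>
          card_image_le.trans ((card_le_card sdiff_subset).trans (hu j' hj').1)
      _ = _ := by simp
  set u' : β → (ι → α) → ℝ := fun j => avoid (D j) (u j) with hu'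
  have hu'0 : ∀ j x, 0 ≤ u' j x := fun j => avoid_nonneg (hu0 j)
  have hu'le : ∀ j x, u' j x ≤ u j x := fun j => avoid_le (hu0 j)
  have hu'mean : ∀ j, (𝔼 x, u j x) / 2 ≤ 𝔼 x, u' j x := by
    intro j
    refine (huglob j).le_expect_avoid (hu0 j) (D j) (le_trans ?_ hrem)
    have : (#(D j) : ℝ) ≤ (Fintype.card β * K : ℕ) := by exact_mod_cast hDcard j
    gcongr
  set Z := T ∪ univ.biUnion S with hZ
  have hZcard : #Z ≤ #T + Fintype.card β * K := by
    refine (card_union_le _ _).trans ?_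
    gcongr
    calc #(univ.biUnion S) ≤ ∑ j, #(S j) := card_biUnion_le
      _ ≤ ∑ _j : β, K := sum_le_sum fun j hj => (hu j hj).1
      _ = _ := by simp
  obtain ⟨Φ, c, hΦ, hΦZ, hpat, hmean⟩ := exists_popular_restriction v u' hu'0
    (fun j x => (hu'le j x).trans (hu1 j x)) (half_pos hε)
    (fun j => (div_le_div_of_nonneg_right (huε j) (by norm_num)).trans (hu'mean j)) Z hV
    (by
      have : (#Z : ℝ) ≤ #T + Fintype.card β * K := by exact_mod_cast hZcard
      linarith) univ
  set I := univ.image Φ with hI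
  rw [card_univ] at hmean
  have hIcard : #I ≤ Fintype.card κ := card_image_le
  set w : β → (ι → α) → ℝ := fun j => restr I (c j) (u' j) with hw
  have hwε : ∀ j, ε' ≤ 𝔼 x, w j x := by
    intro j
    refine le_trans ?_ (hmean j)
    rw [hε']
    have := (div_le_div_of_nonneg_right (huε j) (by norm_num : (0 : ℝ) ≤ 2)).trans (hu'mean j)
    gcongr
  have hε'0 : 0 < ε' := by rw [hε']; positivity
  have hwglob : ∀ j, IsGlobal M (𝔼 x, w j x) (w j) := by
    intro j
    rw [hM]
    refine (huglob j).restr_of_dense hM₀.le (hu'le j) hIcard ?_ (hu0 j)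
    have h2 := hmean j
    rw [div_le_iff₀ (by positivity)] at h2
    have h3 := hu'mean j
    rw [pow_succ]
    linarith
  -- Supplies disjoint blocks of `t` letters, one for each `j`.
  obtain ⟨e⟩ := Function.Embedding.nonempty_of_card_le (α := β × Fin t) (β := α) (by simpa using htα)
  have hcorr0 : 0 ≤ subcubeCorr α t := by
    have h2 : (1 : ℝ) < Fintype.card α := by exact_mod_cast hα
    have h3 : (t : ℝ) ≤ Fintype.card α := by exact_mod_cast htα'
    exact div_nonneg (by linarith) (mul_nonneg (by linarith) (by positivity))
  have hM1 : 1 < M := by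
    rw [hM]; exact one_lt_pow₀ (by linarith) (by omega)
  obtain ⟨x, hx, hxdiff⟩ := exists_pairwise_disagreeing ht hα
    (fun j => univ.image fun s => e (j, s))
    (fun j => by
      rw [card_image_of_injective _ fun s s' h => by simpa using e.injective h]
      simp)
    (fun j j' hjj => by
      rw [Finset.disjoint_left]
      rintro b hb hb'
      obtain ⟨s, -, rfl⟩ := mem_image.1 hb
      obtain ⟨s', -, h⟩ := mem_image.1 hb'
      exact hjj (congrArg Prod.fst (e.injective h)).symm)
    hδβ w (fun j => hε'0.trans_le (hwε j))
    (fun j => by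
      refine le_trans (sub_le_sub_right (stab_mono hcorr0 hlam _) _) ?_
      exact (hwglob j).stab_sub_sq_le (hcorr0.trans hlam) hσ hτ hτ1 hM1 hσM hε'0 (hwε j) hδ hδ1
        hlamδ hn1 hn2 (fun x => hu'0 j _) (fun x => (hu'le j _).trans (hu1 j _)))
  set y : β → ι → α := fun j => I.piecewise (c j) (x j) with hy
  have hyu : ∀ j, u j (y j) ≠ 0 ∧ ∀ d ∈ D j, y j d.1 ≠ d.2 := fun j => of_avoid_ne_zero (hx j)
  have hyS : ∀ j j' i, i ∈ S j' → i ∉ S j → y j i ≠ a j' i := by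
    intro j j' i hi' hi
    exact (hyu j).2 (i, a j' i) (mem_biUnion.2 ⟨j', mem_univ _,
      mem_image.2 ⟨i, mem_sdiff.2 ⟨hi', hi⟩, rfl⟩⟩)
  have hΦS : ∀ p j, Φ p ∉ S j := fun p j h =>
    hΦZ p (mem_univ p) (mem_union_right _ (mem_biUnion.2 ⟨j, mem_univ j, h⟩))
  refine ⟨fun j => (S j).piecewise (a j) (y j), fun j => huf j _ (hyu j).1, Φ,
    fun p q h => hΦ (by simp) (by simp) h, fun p h => hΦZ p (mem_univ p) (mem_union_left _ h), ?_, ?_⟩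
  · intro p j j'
    have hmem : Φ p ∈ I := mem_image_of_mem _ (mem_univ p)
    simp only [piecewise_eq_of_notMem _ _ _ (hΦS p _), hy, piecewise_eq_of_mem _ _ _ hmem]
    exact hpat p (mem_univ p) j j'
  · intro i hiT hiΦ j j' hjj
    have hiI : i ∉ I := by
      intro h
      obtain ⟨p, -, hp⟩ := mem_image.1 h
      exact hiΦ ⟨p, hp⟩
    -- Both fixed: separated by the choice of restrictions. Exactly one fixed: separated by `D`.
    -- Both free: separated by the random subcubes.
    by_cases hi : i ∈ S j <;> by_cases hi' : i ∈ S j'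
    · simp only [piecewise_eq_of_mem _ _ _ hi, piecewise_eq_of_mem _ _ _ hi']
      exact hdiff j (mem_univ j) j' (mem_univ j') hjj i hi hi' hiT
    · simp only [piecewise_eq_of_mem _ _ _ hi, piecewise_eq_of_notMem _ _ _ hi']
      exact (hyS j' j i hi hi').symm
    · simp only [piecewise_eq_of_notMem _ _ _ hi, piecewise_eq_of_mem _ _ _ hi']
      exact hyS j j' i hi' hi
    · simp only [piecewise_eq_of_notMem _ _ _ hi, piecewise_eq_of_notMem _ _ _ hi', hy,
        piecewise_eq_of_notMem _ _ _ hiI]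
      exact hxdiff j j' hjj i

/-! ### Passage from codes to functions, and choice of parameters. -/

open Classical in
lemma expect_restrict_eq_uniformProb {ι α : Type*} [Fintype ι] [DecidableEq ι] [Fintype α]
    [Nonempty α] (R : Finset ι) (B : Set ({i // i ∉ R} → α)) :
    𝔼 x : ι → α, (if (fun i : {i // i ∉ R} => x i) ∈ B then (1 : ℝ) else 0) = uniformProb B := by
  have h := Fintype.expect_equiv (Equiv.piEquivPiSubtypeProd (fun i => i ∈ R) (fun _ => α))
    (fun x => if (fun i : {i // i ∉ R} => x i) ∈ B then (1 : ℝ) else 0)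
    (fun p => if p.2 ∈ B then (1 : ℝ) else 0) (fun x => rfl)
  rw [h, ← univ_product_univ, expect_product]
  trans 𝔼 _i : {i // i ∈ R} → α, 𝔼 y : {i // i ∉ R} → α, if y ∈ B then (1 : ℝ) else 0
  · exact expect_congr rfl fun _ _ => expect_congr rfl fun _ _ => rfl
  rw [expect_const univ_nonempty, Fintype.expect_eq_sum_div_card, uniformProb, Nat.card_eq_fintype_card,
    Set.ncard_eq_toFinset_card']
  simp

open Classical in
lemma Uncapturable.le_expect_avoid {ι α : Type*} [Fintype ι] [DecidableEq ι] [Fintype α]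
    [DecidableEq α] [Nonempty α] {R : Finset ι} {r : ℕ} {ε : ℝ} {A : Set ({i // i ∉ R} → α)}
    (hA : Uncapturable r ε A) {D : Finset (ι × α)} (hD : #D ≤ r) (hDR : ∀ d ∈ D, d.1 ∉ R) :
    ε ≤ 𝔼 x, avoid D
      (fun x : ι → α => if (fun i : {i // i ∉ R} => x i) ∈ A then (1 : ℝ) else 0) x := by
  set D' : Finset ({i // i ∉ R} × α) := D.attach.image fun d => (⟨d.1.1, hDR d.1 d.2⟩, d.1.2)
    with hD'
  have hcard : #D' ≤ r := card_image_le.trans (by rwa [card_attach])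
  have h1 : ε < uniformProb (A \ ⋃ d ∈ D', dictator d.1 d.2) := by
    by_contra! h
    exact hA ⟨D', hcard, h⟩
  refine h1.le.trans (le_of_eq ?_)
  rw [← expect_restrict_eq_uniformProb]
  refine expect_congr rfl fun x _ => ?_
  have hiff : (fun i : {i // i ∉ R} => x i) ∈ ⋃ d ∈ D', dictator d.1 d.2 ↔
      ¬ ∀ d ∈ D, x d.1 ≠ d.2 := by
    simp only [Set.mem_iUnion, dictator, Set.mem_ofPred_eq, exists_prop]
    push Not
    constructor
    · rintro ⟨d, hd, hx⟩
      obtain ⟨d₀, -, rfl⟩ := mem_image.1 hd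
      exact ⟨d₀.1, d₀.2, hx⟩
    · rintro ⟨d, hd, hx⟩
      exact ⟨_, mem_image.2 ⟨⟨d, hd⟩, mem_attach _ _, rfl⟩, hx⟩
  simp only [Set.mem_sdiff, hiff, not_not, avoid]
  by_cases hA : (fun i : {i // i ∉ R} => x i) ∈ A <;> by_cases hD : ∀ d ∈ D, x d.1 ≠ d.2 <;>
    simp only [hA, hD, and_false, true_and, if_true, if_false, and_self]
  all_goals simp

/-- The parameters of `exists_agreement_pattern` can be chosen for all large alphabets. -/
lemma exists_parameters (ℓ h k V : ℕ) :
    ∃ m₀ : ℕ, ∀ m : ℕ, m₀ ≤ m → 3 ≤ m ∧ 2 * V ≤ m ∧ h + 1 ≤ m ∧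
      ∃ M₀ M lam σ τ δ : ℝ, 1 < M₀ ∧ M₀ ^ (4 * (ℓ + 1)) = m ∧ M = (2 * M₀) ^ (ℓ + 1) ∧
        (h * (4 * (ℓ + 1) * k) : ℕ) * M₀ / m ≤ 1 / 2 ∧ lam = 2 * (h + 1) / m ∧
        σ = 4 * (k + 1) * lam ∧ τ = 32 * (k + 1) ^ 2 * lam ∧ τ ≤ 1 ∧ 4 * σ ^ 2 * M ^ 2 ≤ 1 ∧
        0 < δ ∧ δ ≤ 1 ∧ h * δ < 1 ∧ lam ≤ δ ∧
        τ ^ (k + 1) ≤ δ ^ (k + 1) * (((m : ℝ) ^ k)⁻¹ / 2 / 2 ^ ℓ) / 2 ∧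
        τ * (8 * σ ^ 2 * M ^ 2) ^ k ≤ δ ^ (2 * k + 1) * (((m : ℝ) ^ k)⁻¹ / 2 / 2 ^ ℓ) / 2 := by
  -- The `+ 1` gives `h * δ < 1` strictly and covers `h = 0`.
  set δ : ℝ := 1 / (h + 1) with hδ
  set Cσ : ℝ := 4 * (k + 1) * (2 * (h + 1)) with hCσ
  set Cτ : ℝ := 32 * (k + 1) ^ 2 * (2 * (h + 1)) with hCτ
  set Cβ : ℝ := 8 * Cσ ^ 2 * 4 ^ (ℓ + 1) with hCβ
  have hδ0 : 0 < δ := by positivity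
  have hCτ0 : 0 < Cτ := by positivity
  have hCβ0 : 0 < Cβ := by positivity
  set X₁ : ℝ := Cτ ^ (k + 1) * (4 * 2 ^ ℓ) / δ ^ (k + 1) with hX₁
  set X₂ : ℝ := Cτ * Cβ ^ k * (4 * 2 ^ ℓ) / δ ^ (2 * k + 1) with hX₂
  set K : ℕ := h * (4 * (ℓ + 1) * k) with hK
  refine ⟨3 + 2 * V + 2 * (h + 1) ^ 2 + (2 * K) ^ 2 + ⌈Cτ⌉₊ + ⌈Cβ⌉₊ + ⌈X₁⌉₊ + ⌈X₂⌉₊,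
    fun m hm => ?_⟩
  have hm3 : 3 ≤ m := by omega
  have hm0 : (0 : ℝ) < m := by positivity
  have hmτ : Cτ ≤ m := (Nat.le_ceil _).trans (by exact_mod_cast (by omega : ⌈Cτ⌉₊ ≤ m))
  have hmβ : Cβ ≤ m := (Nat.le_ceil _).trans (by exact_mod_cast (by omega : ⌈Cβ⌉₊ ≤ m))
  have hm1 : X₁ ≤ m := (Nat.le_ceil _).trans (by exact_mod_cast (by omega : ⌈X₁⌉₊ ≤ m))
  have hm2 : X₂ ≤ m := (Nat.le_ceil _).trans (by exact_mod_cast (by omega : ⌈X₂⌉₊ ≤ m))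
  have hmh : 2 * ((h : ℝ) + 1) ^ 2 ≤ m := by
    exact_mod_cast (by omega : 2 * (h + 1) ^ 2 ≤ m)
  have hmK : (2 * (K : ℝ)) ^ 2 ≤ m := by exact_mod_cast (by omega : (2 * K) ^ 2 ≤ m)
  have hm1' : (1 : ℝ) < m := by exact_mod_cast (by omega : 1 < m)
  have hpow : 4 * (ℓ + 1) ≠ 0 := by omega
  -- The exponent is small enough that `M₀ ^ 2 ≤ m` and `M ^ 2 ≤ 4 ^ (ℓ + 1) * m`; hence removing
  -- dictators is cheap and `8 * σ ^ 2 * M ^ 2 = O(1 / m)`.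
  set M₀ : ℝ := (m : ℝ) ^ (((4 * (ℓ + 1) : ℕ) : ℝ)⁻¹) with hM₀
  have hM₀pow : M₀ ^ (4 * (ℓ + 1)) = m := Real.rpow_inv_natCast_pow hm0.le hpow
  have hM₀1 : 1 < M₀ := Real.one_lt_rpow hm1' (by positivity)
  have hM₀sq : M₀ ^ 2 ≤ m := by
    rw [← hM₀pow]; exact pow_le_pow_right₀ hM₀1.le (by omega)
  have hM₀l : (M₀ ^ (ℓ + 1)) ^ 2 ≤ m := by
    rw [← pow_mul, ← hM₀pow]; exact pow_le_pow_right₀ hM₀1.le (by omega)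
  have hMsq : ((2 * M₀) ^ (ℓ + 1)) ^ 2 ≤ 4 ^ (ℓ + 1) * m := by
    rw [mul_pow, mul_pow, ← pow_mul 2, mul_comm (ℓ + 1) 2, pow_mul]
    norm_num
    exact hM₀l
  set lam : ℝ := 2 * (h + 1) / m with hlam
  have hσ : 4 * (k + 1) * lam = Cσ / m := by rw [hlam, hCσ]; ring
  have hτ : 32 * (k + 1) ^ 2 * lam = Cτ / m := by rw [hlam, hCτ]; ring
  have hβ : 8 * (4 * (k + 1) * lam) ^ 2 * ((2 * M₀) ^ (ℓ + 1)) ^ 2 ≤ Cβ / m := by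
    rw [hσ]
    calc 8 * (Cσ / m) ^ 2 * ((2 * M₀) ^ (ℓ + 1)) ^ 2
        ≤ 8 * (Cσ / m) ^ 2 * (4 ^ (ℓ + 1) * m) := by gcongr
      _ = Cβ / m := by rw [hCβ]; field_simp
  have hβ1 : Cβ / m ≤ 1 := (div_le_one hm0).2 hmβ
  -- With moment parameter `k`, the left sides of the last two conditions are `O(m ^ (-(k + 1)))`,
  -- against a density of order `m ^ (-k)`. The spare factor `m` beats the constants `X₁` and `X₂`.
  have hε : ∀ d : ℝ, d * (((m : ℝ) ^ k)⁻¹ / 2 / 2 ^ ℓ) / 2 = d * m / (4 * 2 ^ ℓ) / m ^ (k + 1) := by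
    intro d; field_simp; ring
  refine ⟨hm3, by omega, by nlinarith, M₀, (2 * M₀) ^ (ℓ + 1), lam, 4 * (k + 1) * lam,
    32 * (k + 1) ^ 2 * lam, δ, hM₀1, hM₀pow, rfl, ?_, rfl, rfl, rfl, ?_, ?_, hδ0, ?_, ?_, ?_, ?_, ?_⟩
  · rw [div_le_iff₀ hm0]
    have h2 : (2 * K * M₀) ^ 2 ≤ (m : ℝ) ^ 2 := by
      rw [mul_pow, pow_two (m : ℝ)]
      exact mul_le_mul hmK hM₀sq (by positivity) hm0.le
    have h3 := (pow_le_pow_iff_left₀ (by positivity) hm0.le two_ne_zero).1 h2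
    linarith
  · rw [hτ]; exact (div_le_one hm0).2 hmτ
  · have : 0 ≤ (4 * (k + 1) * lam) ^ 2 * ((2 * M₀) ^ (ℓ + 1)) ^ 2 := by positivity
    linarith
  · rw [hδ, div_le_one (by positivity)]
    have : (0 : ℝ) ≤ h := Nat.cast_nonneg h
    linarith
  · rw [hδ, mul_one_div, div_lt_one (by positivity)]
    linarith
  · rw [hlam, hδ, div_le_div_iff₀ hm0 (by positivity)]
    linarith
  · rw [hτ, hε, div_pow]
    refine div_le_div_of_nonneg_right ?_ (by positivity)
    rw [le_div_iff₀ (by positivity)]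
    rw [hX₁, div_le_iff₀ (by positivity)] at hm1
    linarith
  · rw [hτ, hε]
    calc Cτ / m * (8 * (4 * (k + 1) * lam) ^ 2 * ((2 * M₀) ^ (ℓ + 1)) ^ 2) ^ k
        ≤ Cτ / m * (Cβ / m) ^ k := by gcongr
      _ = Cτ * Cβ ^ k / m ^ (k + 1) := by rw [div_pow, pow_succ, div_mul_div_comm]; ring_nf
      _ ≤ _ := by
        refine div_le_div_of_nonneg_right ?_ (by positivity)
        rw [le_div_iff₀ (by positivity)]
        rw [hX₂, div_le_iff₀ (by positivity)] at hm2
        linarith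

end ProductCube

/-! ### The theorem. -/

theorem theorem7p4 {V : Type*} [Finite V] {ℓ h : ℕ} (H : Configuration V ℓ h) (k : ℕ) :
    ∃ r m₀ N : ℕ, ∀ m n : ℕ, m₀ ≤ m → (N : ℝ) * Real.log (m : ℝ) ≤ (n : ℝ) →
      ∀ (R : Fin h → Finset (Fin n)) (A : ∀ j : Fin h, Set ({i : Fin n // i ∉ R j} → Fin m)),
        (∀ j, (R j).card ≤ k) →
        (∀ j, Uncapturable r (((m : ℝ) ^ k)⁻¹) (A j)) →
        ∃ x : ∀ j : Fin h, {i : Fin n // i ∉ R j} → Fin m,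
          (∀ j, x j ∈ A j) ∧
          H.Realises (fun j =>
            restrictOutside (Finset.subset_biUnion_of_mem R (Finset.mem_univ j)) (x j)) := by
  classical
  have := Fintype.ofFinite V
  choose v hv hvu using H.existsUnique_mem
  obtain ⟨m₀, hm₀⟩ := ProductCube.exists_parameters ℓ h k (Fintype.card V)
  set K : ℕ := 4 * (ℓ + 1) * k with hK
  -- Each restriction fixes at most `K` coordinates since `M₀ ^ K = m ^ k`, so at most `h * K`
  -- dictators are ever deleted from a code. The third value adds the coordinates to avoid to the
  -- cost of finding popular ones.
  refine ⟨h * K, m₀, h * k + h * K + ℓ + 16 * h * (k + 1 + ℓ) + 1, ?_⟩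
  intro m n hm hn R A hR hA
  obtain ⟨hm3, hmV, hmh, M₀, M, lam, σ, τ, δ, hM₀1, hM₀, hM, hrem, hlam, hσ, hτ, hτ1, hσM, hδ, hδ1,
    hδh, hlamδ, hn1, hn2⟩ := hm₀ m hm
  have hm0 : (0 : ℝ) < m := by positivity
  have : NeZero m := ⟨by omega⟩
  have hlog : 1 ≤ Real.log m := by
    rw [Real.le_log_iff_exp_le hm0]
    have h2 : (3 : ℝ) ≤ m := by exact_mod_cast hm3
    linarith [Real.exp_one_lt_d9]
  have hK1 : M₀ ^ K * ((m : ℝ) ^ k)⁻¹ = 1 := by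
    rw [hK, pow_mul, hM₀, mul_inv_cancel₀ (by positivity)]
  have hcard : ((Finset.univ.biUnion R).card : ℝ) + Fintype.card (Fin h) * K + Fintype.card (Fin ℓ)
      + 16 * Fintype.card (Fin h)
        * Real.log (1 / (((m : ℝ) ^ k)⁻¹ / 2 / 2 ^ Fintype.card (Fin ℓ)))
      < Fintype.card (Fin n) := by
    simp only [Fintype.card_fin]
    have hT : ((Finset.univ.biUnion R).card : ℝ) ≤ h * k := by
      have : (Finset.univ.biUnion R).card ≤ h * k := by
        calc (Finset.univ.biUnion R).card ≤ ∑ j, (R j).card := Finset.card_biUnion_le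
          _ ≤ ∑ _j : Fin h, k := Finset.sum_le_sum fun j _ => hR j
          _ = h * k := by simp
      exact_mod_cast this
    have hl : Real.log (1 / (((m : ℝ) ^ k)⁻¹ / 2 / 2 ^ ℓ)) ≤ (k + 1 + ℓ) * Real.log m := by
      have e : 1 / (((m : ℝ) ^ k)⁻¹ / 2 / 2 ^ ℓ) = (m : ℝ) ^ k * 2 ^ (1 + ℓ) := by
        rw [pow_add]; field_simp
      have h2 : (2 : ℝ) ≤ m := by exact_mod_cast (by omega : 2 ≤ m)
      have h3 : (m : ℝ) ^ k * 2 ^ (1 + ℓ) ≤ (m : ℝ) ^ (k + 1 + ℓ) := by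
        rw [add_assoc, pow_add (m : ℝ)]
        gcongr
      rw [e]
      refine (Real.log_le_log (by positivity) h3).trans (le_of_eq ?_)
      rw [Real.log_pow]; push_cast; ring
    refine lt_of_lt_of_le ?_ hn
    push_cast
    have h4 : (h * k + h * K + ℓ : ℝ) ≤ (h * k + h * K + ℓ) * Real.log m :=
      le_mul_of_one_le_right (by positivity) hlog
    have h5 : 16 * (h : ℝ) * Real.log (1 / (((m : ℝ) ^ k)⁻¹ / 2 / 2 ^ ℓ))
        ≤ 16 * h * ((k + 1 + ℓ) * Real.log m) := by gcongr
    nlinarith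
  -- The block size `t`; dividing by `h + 1` rather than `h` also covers `h = 0`.
  have ht : 0 < m / (h + 1) := Nat.div_pos hmh (by omega)
  have hth : (h + 1) * (m / (h + 1)) ≤ m := Nat.mul_div_le m (h + 1)
  have hcorr : ProductCube.subcubeCorr (Fin m) (m / (h + 1)) ≤ lam := by
    rw [ProductCube.subcubeCorr, Fintype.card_fin, hlam]
    have h1 : (1 : ℝ) ≤ (m / (h + 1) : ℕ) := by exact_mod_cast ht
    have h2 : (m : ℝ) ≤ 2 * (h + 1) * (m / (h + 1) : ℕ) := by
      have h3 := Nat.lt_mul_div_succ m (b := h + 1) (by omega)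
      have h4 : m ≤ 2 * (h + 1) * (m / (h + 1)) := by nlinarith
      exact_mod_cast h4
    have h3 : (3 : ℝ) ≤ m := by exact_mod_cast hm3
    set t : ℝ := ((m / (h + 1) : ℕ) : ℝ)
    rw [div_le_div_iff₀ (mul_pos (by linarith) (by linarith)) hm0]
    calc ((m : ℝ) - t) * m ≤ (m - 1) * (2 * (h + 1) * t) := by
          apply mul_le_mul <;> linarith
      _ = _ := by ring
  obtain ⟨y, hy, Φ, hΦ, hΦT, hpat, hdiff⟩ := ProductCube.exists_agreement_pattern v
    (fun j (x : Fin n → Fin m) => if (fun i : {i // i ∉ R j} => x i) ∈ A j then (1 : ℝ) else 0)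
    (fun j x => by split_ifs <;> norm_num) (fun j x => by split_ifs <;> norm_num)
    hM₀1 (by positivity) hK1 R
    (fun j D hD hDR => ProductCube.Uncapturable.le_expect_avoid (hA j) (by simpa using hD) hDR)
    (by simpa using hrem) (by simpa using hmV) hcard ht
    (by rw [Fintype.card_fin]; omega) (by rw [Fintype.card_fin, Fintype.card_fin]; nlinarith)
    (by rw [Fintype.card_fin]; exact Nat.div_le_self _ _)
    (n := k) hcorr (by simpa using hM) rfl hσ hτ hτ1 hσM hδ hδ1 (by simpa using hδh) hlamδ
    (by simpa using hn1) (by simpa using hn2)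
  refine ⟨fun j i => y j i, fun j => ?_, ⟨fun p => ⟨Φ p, hΦT p⟩, fun p q hpq => ?_⟩, ?_⟩
  · by_contra hj
    exact hy j (if_neg hj)
  · exact hΦ (congrArg Subtype.val hpq)
  · intro j j' hjj i
    have hvertex : ∀ p, (H.edge j ∩ H.edge j' ∩ {v | H.part v = p}).Nonempty ↔ v j p = v j' p := by
      intro p
      constructor
      · rintro ⟨z, ⟨hz, hz'⟩, hzp⟩
        rw [← hvu j p z ⟨hz, hzp⟩, ← hvu j' p z ⟨hz', hzp⟩]
      · intro h
        exact ⟨v j p, ⟨(hv j p).1, h ▸ (hv j' p).1⟩, (hv j p).2⟩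
    simp only [restrictOutside, hvertex]
    constructor
    · intro heq
      by_contra hcon
      refine hdiff i i.2 ?_ j j' hjj heq
      rintro ⟨p, hp⟩
      refine hcon ⟨p, Subtype.ext hp.symm, ?_⟩
      rw [← hpat p j j', hp]
      exact heq
    · rintro ⟨p, rfl, hp⟩
      exact (hpat p j j').2 hp
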